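/- Let $I_n$ be the kernel of the ring homomorphism $\mathbb{C}[x_{ij} \mid 1\le i<j\le n]\to\mathbb{C}[t_1,\dots,t_n]$, $x_{ij}\mapsto t_it_j$ (the toric ideal of the second hypersimplex), and write $x_{ji}=x_{ij}$. Place $1,\dots,n$ in this order on a circle. A circular term order $\prec$ is a block term order on $\mathbb{C}[x_{ij}]$ whose blocks consist of the variables $x_{ij}$ with a given value of $\min(|i-j|,\,n-|i-j|)$, the blocks with smaller value being the larger ones (so two monomials are compared by their parts in the first block in which they differ). For an ideal $I\subseteq\mathbb{C}[x]$ let $I^{\{2\}}$ denote its secant ideal, $I^{\{2\}}=\bigl(I(y)+I(z)+\langle x_{ij}-y_{ij}-z_{ij}\rangle\bigr)\cap\mathbb{C}[x]$. Let $\prec$ be any circular term order. When $n=5$, ${\rm in}_\prec(I_5)^{\{2\}}=\langle x_{12}x_{23}x_{34}x_{45}x_{15}\rangle$. For $n\ge 6$, ${\rm in}_\prec(I_n)^{\{2\}}$ is a monomial ideal, generated by its minimal monomial generators, and these are exactly the following monomials: 1. $x_{i_1i_2}x_{i_3i_4}x_{i_5i_6}$ and $x_{i_1i_6}x_{i_2i_5}x_{i_3i_4}$,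 where $i_1<i_2<i_3<i_4<i_5<i_6<i_1$ in the circular order (exactly one revolution around the circle); 2. $\prod_{l=1}^{2k+1}x_{i_l\,j_{l+k-1}}$, where $k>1$, the index $l+k-1$ is taken modulo $2k+1$, and $i_1\le j_1<i_2\le j_2<\cdots<i_{2k+1}\le j_{2k+1}<i_1$ in the circular order (exactly one revolution around the circle). The degrees of these minimal generators are exactly the odd integers $d$ with $3\le d\le n$. -/

import Mathlib

open MvPolynomial

noncomputable section

namespace Hypersimplex

/-! ### Secant ideals -/

/-- The `r`-th secant ideal `I^{r}` of an ideal `I` of `K[x]`, i.e. the `r`-fold join of `I` with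
itself. In the polynomial ring with the variables `x i` (written `X (inl i)`) and `r` further copies
`y a i` of them (written `X (inr (a, i))`), take the ideal
`I(y 1) + ... + I(y r) + ⟨x i - (y 1 i + ... + y r i) : i⟩` and eliminate all the `y a i`. -/
def secantIdeal {σ K : Type*} [Field K] (r : ℕ) (I : Ideal (MvPolynomial σ K)) :
    Ideal (MvPolynomial σ K) :=
  Ideal.comap (rename (R := K) (Sum.inl : σ → σ ⊕ (Fin r × σ)))
    ((⨆ a : Fin r, Ideal.map (rename (R := K) fun i : σ => (Sum.inr (a, i) : σ ⊕ (Fin r × σ))) I) ⊔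
      Ideal.span (Set.range fun i : σ =>
        (X (Sum.inl i) - ∑ a : Fin r, X (Sum.inr (a, i)) : MvPolynomial (σ ⊕ (Fin r × σ)) K)))

/-! ### Initial ideals and minimal generators of monomial ideals -/

/-- The initial ideal of `I` with respect to a term order, generated by the leading terms of the
elements of `I`. -/
def initialIdeal {σ K : Type*} [Field K] (m : MonomialOrder σ) (I : Ideal (MvPolynomial σ K)) :
    Ideal (MvPolynomial σ K) :=
  Ideal.span (m.leadingTerm '' (I : Set (MvPolynomial σ K)))

/-- The minimal monomials of an ideal `J`: the monomials in `J` of which no proper divisor is in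
`J`. If `J` is a monomial ideal, these are its minimal generators. -/
def minimalGenerators {σ K : Type*} [Field K] (J : Ideal (MvPolynomial σ K)) :
    Set (MvPolynomial σ K) :=
  {f | ∃ s : σ →₀ ℕ, f = monomial s 1 ∧ f ∈ J ∧
    ∀ t : σ →₀ ℕ, t < s → (monomial t 1 : MvPolynomial σ K) ∉ J}

/-! ### The toric ideal of the second hypersimplex -/

/-- The edges of the complete graph on the vertices `Fin n`; vertex `v` of `{1, ..., n}` is
represented by `v - 1`. -/
abbrev Edge (n : ℕ) : Type := {e : Sym2 (Fin n) // ¬ e.IsDiag}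

/-- The ring homomorphism `ℂ[x_{ij}] → ℂ[t_i]`, `x_{ij} ↦ t_i t_j`. -/
def phi (n : ℕ) : MvPolynomial (Edge n) ℂ →ₐ[ℂ] MvPolynomial (Fin n) ℂ :=
  aeval fun e : Edge n => Sym2.mul (e.1.map fun i => (X i : MvPolynomial (Fin n) ℂ))

/-- The toric ideal of the second hypersimplex. -/
def toricIdeal (n : ℕ) : Ideal (MvPolynomial (Edge n) ℂ) := RingHom.ker (phi n)

/-- The variable `x_{ij} = x_{ji}` of the edge joining the distinct vertices `i` and `j`. (The value
for `i = j` plays no role.) -/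
def x {n : ℕ} (i j : Fin n) : MvPolynomial (Edge n) ℂ :=
  if h : i = j then 0 else X ⟨s(i, j), by simpa using h⟩

/-! ### Circular term orders -/

/-- The number of steps from `p` to `v`, between `0` and `n - 1`, going once around the circle on
which `0, 1, ..., n - 1` are placed in this order. -/
def steps {n : ℕ} (p v : Fin n) : ℕ := (v - p).val

/-- The class of an edge of the regular `n`-gon under the dihedral group: the length `1, 2, ...,
⌊n / 2⌋` of the shorter one of the two arcs between the ends of the edge. -/
def edgeClass {n : ℕ} (e : Edge n) : ℕ :=
  Sym2.lift ⟨fun i j : Fin n => min (steps i j) (steps j i), fun _ _ => min_comm _ _⟩ e.1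

/-- A circular term order: a block term order whose blocks of variables are the classes of edges,
the smaller classes being the larger blocks. That is, two monomials are compared by
comparing their parts in the first block where these parts differ. -/
def IsCircular {n : ℕ} (m : MonomialOrder (Edge n)) : Prop :=
  ∀ (c : ℕ) (u v : Edge n →₀ ℕ), (∀ e, edgeClass e < c → u e = v e) →
    m.toSyn (u.filter fun e => edgeClass e = c) < m.toSyn (v.filter fun e => edgeClass e = c) →
    m.toSyn u < m.toSyn v

/-! ### Circular sequences and their monomials -/

/-- `v_1 < v_2 < ... < v_m < v_1` in the circular order, with exactly one revolution: the sequence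
is increasing when the vertices are read around the circle from a suitable starting vertex. -/
def CircularlyIncreasing {n m : ℕ} (v : Fin m → Fin n) : Prop :=
  ∃ p : Fin n, ∀ a b : Fin m, a < b → steps p (v a) < steps p (v b)

/-- Admissible sequences: `i_1 ≤ j_1 < i_2 ≤ j_2 < ... < i_m ≤ j_m < i_1` in the circular order,
with exactly one revolution. -/
def Admissible {n m : ℕ} (i j : Fin m → Fin n) : Prop :=
  ∃ p : Fin n, (∀ a : Fin m, steps p (i a) ≤ steps p (j a)) ∧
    ∀ a b : Fin m, a < b → steps p (j a) < steps p (i b)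

/-- The monomials `x_{i_1 i_2} x_{i_3 i_4} x_{i_5 i_6}` and `x_{i_1 i_6} x_{i_2 i_5} x_{i_3 i_4}`
for circularly increasing `i_1, ..., i_6`. -/
def tripleMonomials (n : ℕ) : Set (MvPolynomial (Edge n) ℂ) :=
  {f | ∃ v : Fin 6 → Fin n, CircularlyIncreasing v ∧
    (f = x (v 0) (v 1) * x (v 2) (v 3) * x (v 4) (v 5) ∨
      f = x (v 0) (v 5) * x (v 1) (v 4) * x (v 2) (v 3))}

/-- The monomial `∏_l x_{i_l j_{l + k - 1}}`, with the index `l + k - 1` modulo `2 k + 1`. -/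
def cycleMonomial {n k : ℕ} (i j : Fin (2 * k + 1) → Fin n) : MvPolynomial (Edge n) ℂ :=
  ∏ l : Fin (2 * k + 1), x (i l) (j (Fin.ofNat (2 * k + 1) (l.val + k - 1)))

/-- The monomials of the admissible sequences of length `2 k + 1`, where `k > 1`. -/
def cycleMonomials (n : ℕ) : Set (MvPolynomial (Edge n) ℂ) :=
  {f | ∃ k : ℕ, 1 < k ∧ ∃ i j : Fin (2 * k + 1) → Fin n, Admissible i j ∧ f = cycleMonomial i j}

end Hypersimplex

end

/-! The toric ideal degenerates to the edge ideal of a graph, and the secant ideal of an edge ideal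
is read off from the odd cycles of the graph.

Two disjoint chords of the `n`-gon can be exchanged for two crossing chords with the same ends, and
a circular order makes the disjoint pair the leading term of the resulting binomial. A multigraph
without disjoint edges is determined by its vertex degrees, so these binomials already produce the
whole initial ideal: it is the edge ideal of `disjointnessGraph` (`initialIdeal_toricIdeal`).

In characteristic zero, a monomial lies in the secant ideal of a monomial ideal `J` exactly when
every factorization of it into two monomials has a factor in `J`. For an edge ideal, a factorization
with no factor in `J` gives a 2-colouring of the support and conversely. Hence the secant ideal
consists of the monomials with non-bipartite support, and its minimal generators are the induced odd
cycles (`minimalGenerators_secantIdeal_edgeIdeal`).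

It remains to find the induced odd cycles of `disjointnessGraph`
(`oddCycleMonomials_disjointnessGraph`). Three pairwise disjoint chords are side by side or
parallel. A longer cycle is lifted to the universal cover of the circle, each chord being placed in
the gap after its predecessor. The absence of chords of the cycle forces the lift to advance in one
direction (`IsLiftedWalk.forward_succ`) and to wind `k + 1` times for length `2 * k + 1`
(`IsLiftedWalk.winding_eq`). Read in steps of two, the ends of the chords then interlace in a single
revolution, which is an admissible sequence. Conversely, the chords of an admissible sequence form a
circulant graph that is a single cycle. -/

namespace Hypersimplex

/-! ### Secant ideals of monomial ideals -/

section Secant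

variable {σ K : Type*} [Field K]

/-- The substitution `x i ↦ y 1 i + ... + y r i`. -/
noncomputable def joinHom (σ K : Type*) [Field K] (r : ℕ) :
    MvPolynomial σ K →ₐ[K] MvPolynomial (Fin r × σ) K :=
  aeval fun i => ∑ a : Fin r, X (a, i)

/-- Modulo the linear forms each `x i` equals the sum of its copies, so eliminating the copies
amounts to taking a preimage under the substitution. -/
lemma mem_secantIdeal_iff {r : ℕ} {I : Ideal (MvPolynomial σ K)} {f : MvPolynomial σ K} :
    f ∈ secantIdeal r I ↔
      joinHom σ K r f ∈ ⨆ a : Fin r, Ideal.map (rename (R := K) fun i : σ => (a, i)) I := by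
  set Q' : Ideal (MvPolynomial (Fin r × σ) K) :=
    ⨆ a : Fin r, Ideal.map (rename (R := K) fun i : σ => (a, i)) I with hQ'
  set Q : Ideal (MvPolynomial (σ ⊕ (Fin r × σ)) K) :=
    ⨆ a : Fin r, Ideal.map (rename (R := K) fun i : σ => (Sum.inr (a, i) : σ ⊕ (Fin r × σ))) I
    with hQ
  set D : Ideal (MvPolynomial (σ ⊕ (Fin r × σ)) K) :=
    Ideal.span (Set.range fun i : σ =>
      (X (Sum.inl i) - ∑ a : Fin r, X (Sum.inr (a, i)) : MvPolynomial (σ ⊕ (Fin r × σ)) K)) with hD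
  let ψ : MvPolynomial (σ ⊕ (Fin r × σ)) K →ₐ[K] MvPolynomial (Fin r × σ) K :=
    aeval (Sum.elim (fun i => ∑ a : Fin r, X (a, i)) X)
  have hψ : ∀ g, ψ (rename Sum.inl g) = joinHom σ K r g := fun g => by
    rw [← AlgHom.comp_apply]
    congr 1
    exact MvPolynomial.algHom_ext (fun i => by simp [ψ, joinHom])
  have hψ' : ∀ (a : Fin r) (g : MvPolynomial σ K),
      ψ (rename (fun i => Sum.inr (a, i)) g) = rename (fun i => (a, i)) g := fun a g => by
    rw [← AlgHom.comp_apply]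
    congr 1
    exact MvPolynomial.algHom_ext (fun i => by simp [ψ])
  have hD0 : ∀ P, Ideal.Quotient.mk D (rename Sum.inr (ψ P)) = Ideal.Quotient.mk D P := by
    have : ((Ideal.Quotient.mkₐ K D).comp (rename Sum.inr)).comp ψ = Ideal.Quotient.mkₐ K D := by
      apply MvPolynomial.algHom_ext
      rintro (i | i)
      · simp only [ψ, AlgHom.comp_apply, aeval_X, Sum.elim_inl, map_sum, rename_X]
        rw [← map_sum, eq_comm, Ideal.Quotient.mkₐ_eq_mk, Ideal.Quotient.eq]
        exact Ideal.subset_span ⟨i, rfl⟩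
      · simp [ψ]
    intro P
    exact DFunLike.congr_fun this P
  change rename Sum.inl f ∈ Q ⊔ D ↔ _
  constructor
  · intro hf
    have hle : Q ⊔ D ≤ Ideal.comap ψ Q' := by
      refine sup_le (iSup_le fun a => Ideal.map_le_iff_le_comap.2 fun g hg => ?_)
        (Ideal.span_le.2 ?_)
      · rw [Ideal.mem_comap, Ideal.mem_comap, hψ']
        exact (le_iSup (fun a : Fin r => Ideal.map (rename (R := K) fun i : σ => (a, i)) I) a)
          (Ideal.mem_map_of_mem _ hg)
      · rintro _ ⟨i, rfl⟩
        simp [ψ]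
    rw [← hψ]
    exact hle hf
  · intro hf
    have hle : Q' ≤ Ideal.comap (rename (R := K) (Sum.inr : _ → σ ⊕ (Fin r × σ))) Q := by
      refine iSup_le fun a => Ideal.map_le_iff_le_comap.2 fun g hg => ?_
      rw [Ideal.mem_comap, Ideal.mem_comap, rename_rename]
      exact (le_iSup (fun a : Fin r => Ideal.map (rename (R := K)
        fun i : σ => (Sum.inr (a, i) : σ ⊕ (Fin r × σ))) I) a) (Ideal.mem_map_of_mem _ hg)
    have h1 := hle hf
    rw [Ideal.mem_comap, ← hψ] at h1
    have h2 := hD0 (rename Sum.inl f)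
    rw [eq_comm, Ideal.Quotient.eq] at h2
    have := Ideal.add_mem _ ((le_sup_right : D ≤ Q ⊔ D) h2) ((le_sup_left : Q ≤ Q ⊔ D) h1)
    simpa using this

/-- `N` is a product of multinomial coefficients. That it is a natural number matters: in
characteristic zero it vanishes only for the evident reason. -/
lemma coeff_joinHom_monomial (r : ℕ) (u : σ →₀ ℕ) (d : Fin r × σ →₀ ℕ) :
    ∃ N : ℕ, coeff d (joinHom σ K r (monomial u 1)) = N ∧
      (N ≠ 0 ↔ Finsupp.mapDomain Prod.snd d = u) := by
  classical
  induction hm : u.degree generalizing u d with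
  | zero =>
    obtain rfl : u = 0 := u.degree_eq_zero_iff.1 hm
    refine ⟨if 0 = d then 1 else 0, ?_, ?_⟩
    · have : (monomial 0 1 : MvPolynomial σ K) = 1 := rfl
      rw [this, map_one, coeff_one]
      split_ifs <;> simp
    · rcases eq_or_ne 0 d with rfl | h
      · simp
      · simp only [h, if_false, ne_eq, not_true_eq_false, false_iff]
        intro h0
        refine h (Finsupp.ext fun p => ?_)
        have h1 := DFunLike.congr_fun h0 p.2
        rw [Finsupp.mapDomain, Finsupp.sum_apply, Finsupp.sum] at h1
        by_contra hp
        have hp' : p ∈ d.support := by simpa [eq_comm] using hp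
        have := (Finset.sum_eq_zero_iff.1 h1) p hp'
        simp at this
        exact hp this.symm
  | succ m ih =>
    have hu0 : u ≠ 0 := by rintro rfl; simp at hm
    obtain ⟨i, hi⟩ := Finsupp.support_nonempty_iff.2 hu0
    have hu : u = (u - Finsupp.single i 1) + Finsupp.single i 1 := by
      rw [tsub_add_cancel_of_le]
      simpa [Nat.one_le_iff_ne_zero] using hi
    generalize u - Finsupp.single i 1 = v at hu
    subst hu
    have hv : v.degree = m := by
      rw [map_add, Finsupp.degree_single] at hm; omega
    have hmon : (monomial (v + Finsupp.single i 1) 1 : MvPolynomial σ K) = monomial v 1 * X i := by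
      rw [X, monomial_mul, one_mul]
    choose N hN hN' using fun a : Fin r => ih v (d - Finsupp.single (a, i) 1) hv
    refine ⟨∑ a, if (a, i) ∈ d.support then N a else 0, ?_, ?_⟩
    · rw [hmon, map_mul]
      have : joinHom σ K r (X i) = ∑ a : Fin r, X (a, i) := by simp [joinHom]
      rw [this, Finset.mul_sum, coeff_sum]
      simp only [coeff_mul_X', hN]
      push_cast
      rfl
    · have key : ∀ a, (a, i) ∈ d.support → (N a ≠ 0 ↔
          Finsupp.mapDomain Prod.snd d = v + Finsupp.single i 1) := by
        intro a ha
        have hd : d = (d - Finsupp.single (a, i) 1) + Finsupp.single (a, i) 1 := by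
          rw [tsub_add_cancel_of_le]
          simpa [Nat.one_le_iff_ne_zero] using ha
        rw [hN']
        conv_rhs => rw [hd, Finsupp.mapDomain_add, Finsupp.mapDomain_single]
        simp
      constructor
      · intro h
        obtain ⟨a, -, ha⟩ := Finset.exists_ne_zero_of_sum_ne_zero h
        split_ifs at ha with h1
        · exact (key a h1).1 ha
        · exact absurd rfl ha
      · intro h h0
        have hex : ∃ a, (a, i) ∈ d.support := by
          by_contra! hno
          have := DFunLike.congr_fun h i
          rw [Finsupp.mapDomain, Finsupp.sum_apply, Finsupp.sum, Finset.sum_eq_zero] at this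
          · simp at this
          · rintro ⟨a, j⟩ hj
            rcases eq_or_ne j i with rfl | hji
            · exact absurd hj (hno a)
            · simp [hji]
        obtain ⟨a, ha⟩ := hex
        have := (Finset.sum_eq_zero_iff.1 h0) a (Finset.mem_univ a)
        rw [if_pos ha] at this
        exact (key a ha).2 h this

/-- The monomial `d` arises only from the single monomial of `f` to which it projects, so terms of
`f` never cancel after the substitution. -/
lemma coeff_joinHom_ne_zero_iff [CharZero K] {r : ℕ} {f : MvPolynomial σ K}
    {d : Fin r × σ →₀ ℕ} :
    coeff d (joinHom σ K r f) ≠ 0 ↔ coeff (Finsupp.mapDomain Prod.snd d) f ≠ 0 := by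
  choose N hN hN' using fun u : σ →₀ ℕ => coeff_joinHom_monomial (K := K) r u d
  have h : coeff d (joinHom σ K r f) = coeff (Finsupp.mapDomain Prod.snd d) f *
      (N (Finsupp.mapDomain Prod.snd d)) := by
    conv_lhs => rw [f.as_sum, map_sum, coeff_sum]
    have : ∀ u ∈ f.support, coeff d (joinHom σ K r (monomial u (coeff u f))) =
        coeff u f * N u := by
      intro u _
      have h1 : (monomial u (coeff u f) : MvPolynomial σ K) = coeff u f • monomial u 1 := by
        rw [smul_monomial, smul_eq_mul, mul_one]
      rw [← hN, h1, map_smul, coeff_smul, smul_eq_mul]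
    rw [Finset.sum_congr rfl this, Finset.sum_eq_single (Finsupp.mapDomain Prod.snd d)]
    · intro u _ hu
      have : N u = 0 := by
        by_contra h; exact hu ((hN' u).1 h).symm
      simp [this]
    · intro h
      simp [notMem_support_iff.1 h]
  rw [h]
  simp [(hN' _).2 rfl]

lemma mem_secantIdeal_span_monomial [CharZero K] {s : Set (σ →₀ ℕ)} {f : MvPolynomial σ K} :
    f ∈ secantIdeal 2 (Ideal.span ((fun t => monomial t (1 : K)) '' s)) ↔
      ∀ u ∈ f.support, ∀ b c : σ →₀ ℕ, b + c = u → (∃ t ∈ s, t ≤ b) ∨ ∃ t ∈ s, t ≤ c := by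
  classical
  have hmap : (⨆ a : Fin 2, Ideal.map (rename (R := K) fun i : σ => (a, i))
      (Ideal.span ((fun t => monomial t (1 : K)) '' s))) =
      Ideal.span ((fun t => monomial t (1 : K)) ''
        (⋃ a : Fin 2, (Finsupp.mapDomain fun i : σ => (a, i)) '' s)) := by
    simp only [Ideal.map_span, Set.image_iUnion, Ideal.span_iUnion, Set.image_image,
      rename_monomial]
  have hle : ∀ (a : Fin 2) (t : σ →₀ ℕ) (b : Fin 2 → σ →₀ ℕ),
      Finsupp.mapDomain (fun i => (a, i)) t ≤
        (∑ c, Finsupp.mapDomain (fun i => (c, i)) (b c)) ↔ t ≤ b a := by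
    intro a t b
    have hinj : ∀ c : Fin 2, Function.Injective fun i : σ => (c, i) := fun c i j h => by
      simpa using h
    have hval : ∀ i, (∑ c, Finsupp.mapDomain (fun i => (c, i)) (b c)) (a, i) = b a i := by
      intro i
      rw [Finsupp.finsetSum_apply, Finset.sum_eq_single a]
      · exact Finsupp.mapDomain_apply (hinj a) _ _
      · intro c _ hc
        apply Finsupp.mapDomain_of_notMem_range
        rintro ⟨j, hj⟩
        exact hc (congrArg Prod.fst hj)
      · simp
    constructor
    · intro h i
      have := h (a, i)
      rwa [hval, Finsupp.mapDomain_apply (hinj a) t i] at this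
    · rintro h ⟨c, i⟩
      rcases eq_or_ne c a with rfl | hc
      · rw [hval, Finsupp.mapDomain_apply (hinj c) t i]
        exact h i
      · rw [Finsupp.mapDomain_of_notMem_range]
        · exact Nat.zero_le _
        · rintro ⟨j, hj⟩
          exact hc (congrArg Prod.fst hj).symm
  have hid : ∀ b : σ →₀ ℕ, Finsupp.mapDomain (fun i => i) b = b := fun b => Finsupp.mapDomain_id
  rw [mem_secantIdeal_iff, hmap, mem_ideal_span_monomial_image]
  constructor
  · intro h u hu b c hbc
    set B : Fin 2 → σ →₀ ℕ := ![b, c]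
    have hd : Finsupp.mapDomain Prod.snd
        (∑ a, Finsupp.mapDomain (fun i : σ => (a, i)) (B a)) = u := by
      rw [Fin.sum_univ_two, Finsupp.mapDomain_add, ← Finsupp.mapDomain_comp,
        ← Finsupp.mapDomain_comp]
      simp only [Function.comp_def, hid]
      simpa [B] using hbc
    obtain ⟨t, ht, htd⟩ := h (∑ a, Finsupp.mapDomain (fun i : σ => (a, i)) (B a)) (by
      rw [mem_support_iff, coeff_joinHom_ne_zero_iff, hd]
      exact mem_support_iff.1 hu)
    obtain ⟨a, t, hts, rfl⟩ := Set.mem_iUnion.1 ht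
    rw [hle] at htd
    fin_cases a
    · exact Or.inl ⟨t, hts, htd⟩
    · exact Or.inr ⟨t, hts, htd⟩
  · intro h d hd
    rw [mem_support_iff, coeff_joinHom_ne_zero_iff, ← mem_support_iff] at hd
    set B : Fin 2 → σ →₀ ℕ := fun a => Finsupp.comapDomain (fun i => (a, i)) d
      (fun i _ j _ h => by simpa using h)
    have hdB : d = ∑ a, Finsupp.mapDomain (fun i : σ => (a, i)) (B a) := by
      ext ⟨a, i⟩
      rw [Finsupp.finsetSum_apply, Finset.sum_eq_single a]
      · rw [Finsupp.mapDomain_apply (fun i j h => by simpa using h)]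
        rfl
      · intro c _ hc
        apply Finsupp.mapDomain_of_notMem_range
        rintro ⟨j, hj⟩
        exact hc (congrArg Prod.fst hj)
      · simp
    have hsum : B 0 + B 1 = Finsupp.mapDomain Prod.snd d := by
      conv_rhs => rw [hdB]
      rw [Fin.sum_univ_two, Finsupp.mapDomain_add, ← Finsupp.mapDomain_comp,
        ← Finsupp.mapDomain_comp]
      simp only [Function.comp_def, hid]
    rcases h _ hd _ _ hsum with ⟨t, hts, ht⟩ | ⟨t, hts, ht⟩
    · exact ⟨_, Set.mem_iUnion.2 ⟨0, t, hts, rfl⟩, by rw [hdB, hle]; exact ht⟩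
    · exact ⟨_, Set.mem_iUnion.2 ⟨1, t, hts, rfl⟩, by rw [hdB, hle]; exact ht⟩

end Secant

/-! ### Induced odd cycles and secant ideals of edge ideals -/

section OddCycles

variable {V : Type*} {G : SimpleGraph V}

/-- A closed walk of length `N`, as a periodic sequence of vertices. -/
structure IsClosedWalk (G : SimpleGraph V) (N : ℕ) (e : ℕ → V) : Prop where
  adj : ∀ t, G.Adj (e t) (e (t + 1))
  periodic : Function.Periodic e N

/-- An induced cycle of odd length `N` (possibly a triangle), as a periodic sequence of vertices. -/
structure IsInducedOddCycle (G : SimpleGraph V) (N : ℕ) (e : ℕ → V) : Prop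
    extends IsClosedWalk G N e where
  odd : Odd N
  three_le : 3 ≤ N
  ne : ∀ t d, 1 ≤ d → d < N → e t ≠ e (t + d)
  not_adj : ∀ t d, 2 ≤ d → d + 2 ≤ N → ¬ G.Adj (e t) (e (t + d))

lemma eq_of_modEq_of_periodic {N : ℕ} {e : ℕ → V} (h : Function.Periodic e N) {a b : ℕ}
    (hab : a ≡ b [MOD N]) : e a = e b := by
  rw [← h.map_mod_nat a, ← h.map_mod_nat b, hab]

lemma isClosedWalk_of_adj {e : ℕ → V} (he : ∀ t, G.Adj (e t) (e (t + 1))) {s m : ℕ}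
    (h : G.Adj (e (s + m)) (e s)) : IsClosedWalk G (m + 1) fun t => e (s + t % (m + 1)) where
  adj t := by
    have hlt : t % (m + 1) < m + 1 := Nat.mod_lt t (Nat.succ_pos m)
    have hmod : (t + 1) % (m + 1) = (t % (m + 1) + 1) % (m + 1) := by simp
    rcases Nat.lt_succ_iff_lt_or_eq.1 hlt with h1 | h1
    · have : (t + 1) % (m + 1) = t % (m + 1) + 1 := by
        rw [hmod]
        exact Nat.mod_eq_of_lt (by omega)
      simp only [this]
      exact he _
    · have h2 : (t + 1) % (m + 1) = 0 := by
        rw [hmod, h1]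
        exact Nat.mod_self _
      simp only [h1, h2]
      exact h
  periodic t := by simp

lemma alternating_of_step {P : ℕ → Prop} (h : ∀ t, P (t + 1) ↔ ¬ P t) {N : ℕ} (hN : Odd N) :
    P N ↔ ¬ P 0 := by
  obtain ⟨k, rfl⟩ := hN
  have : ∀ k, P (2 * k) ↔ P 0 := by
    intro k
    induction k with
    | zero => rfl
    | succ k ih => rw [← ih, show 2 * (k + 1) = 2 * k + 1 + 1 by ring, h, h, not_not]
  rw [h, this]

lemma exists_isClosedWalk_of_not_colorable {U : Set V} (h : ¬ (G.induce U).Colorable 2) :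
    ∃ N e, Odd N ∧ IsClosedWalk G N e ∧ ∀ t, e t ∈ U := by
  rw [SimpleGraph.two_colorable_iff_forall_loop_even] at h
  push Not at h
  obtain ⟨u, w, hw⟩ := h
  have hpos : 0 < w.length := (Nat.not_even_iff_odd.1 hw).pos
  refine ⟨w.length, fun t => (w.getVert (t % w.length)).1, Nat.not_even_iff_odd.1 hw,
    ⟨fun t => ?_, fun t => by simp⟩, fun t => Subtype.coe_prop _⟩
  have hlt := Nat.mod_lt t hpos
  have key := w.adj_getVert_succ hlt
  have hmod : (t + 1) % w.length = (t % w.length + 1) % w.length := by simp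
  rcases Nat.lt_or_ge (t % w.length + 1) w.length with h1 | h1
  · simp only [hmod, Nat.mod_eq_of_lt h1]
    exact key
  · have h2 : t % w.length + 1 = w.length := by omega
    rw [h2, SimpleGraph.Walk.getVert_length] at key
    simp only [hmod, h2, Nat.mod_self, SimpleGraph.Walk.getVert_zero]
    exact key

lemma exists_isInducedOddCycle {U : Set V}
    (h : ∃ N e, Odd N ∧ IsClosedWalk G N e ∧ ∀ t, e t ∈ U) :
    ∃ N e, IsInducedOddCycle G N e ∧ ∀ t, e t ∈ U := by
  classical
  obtain ⟨e, hodd, hw, hU⟩ := Nat.find_spec h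
  have hmin : ∀ M e', Odd M → IsClosedWalk G M e' → (∀ t, e' t ∈ U) → Nat.find h ≤ M :=
    fun M e' h1 h2 h3 => Nat.find_min' h ⟨e', h1, h2, h3⟩
  generalize Nat.find h = N at *
  -- An edge closing an even stretch of the walk gives a shorter odd closed walk. Below, a
  -- repetition or a chord is excluded by going along the side of it that has the right parity.
  have hret : ∀ s m, Even m → m + 1 < N → ¬ G.Adj (e (s + m)) (e s) := by
    intro s m hm hlt hadj
    have := hmin (m + 1) _ hm.add_one (isClosedWalk_of_adj hw.adj hadj) fun t => hU _
    omega
  have hper : ∀ t, e (t + N) = e t := hw.periodic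
  refine ⟨N, e, ⟨hw, hodd, ?_, ?_, ?_⟩, hU⟩
  · obtain ⟨k, hk⟩ := hodd
    rcases Nat.eq_zero_or_pos k with rfl | hk0
    · have := hw.adj 0
      have h1 := hper 0
      simp only [mul_zero, zero_add] at hk
      rw [hk] at h1
      rw [h1] at this
      exact absurd this (G.irrefl)
    · omega
  · intro t d hd hdN heq
    rcases Nat.even_or_odd d with hev | hod
    · refine hret (t + d) (N - d - 1) ?_ (by omega) ?_
      · obtain ⟨k, hk⟩ := hodd
        obtain ⟨l, hl⟩ := hev
        exact ⟨k - l, by omega⟩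
      · have := hw.adj (t + d + (N - d - 1))
        rwa [show t + d + (N - d - 1) + 1 = t + N by omega, hper, heq] at this
    · refine hret t (d - 1) ?_ (by omega) ?_
      · obtain ⟨l, hl⟩ := hod
        exact ⟨l, by omega⟩
      · have := hw.adj (t + (d - 1))
        rwa [show t + (d - 1) + 1 = t + d by omega, ← heq] at this
  · intro t d hd hdN hadj
    rcases Nat.even_or_odd d with hev | hod
    · exact hret t d hev (by omega) hadj.symm
    · refine hret (t + d) (N - d) ?_ (by omega) ?_
      · obtain ⟨k, hk⟩ := hodd
        obtain ⟨l, hl⟩ := hod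
        exact ⟨k - l, by omega⟩
      · rwa [show t + d + (N - d) = t + N by omega, hper]

/-- The edge ideal of a graph. -/
noncomputable def edgeIdeal (K : Type*) [Field K] (G : SimpleGraph V) :
    Ideal (MvPolynomial V K) :=
  Ideal.span ((fun t => monomial t (1 : K)) ''
    {t | ∃ a b, G.Adj a b ∧ t = Finsupp.single a 1 + Finsupp.single b 1})

lemma exists_edge_le_iff {b : V →₀ ℕ} :
    (∃ t ∈ {t | ∃ x y, G.Adj x y ∧ t = Finsupp.single x 1 + Finsupp.single y 1}, t ≤ b) ↔
      ∃ x y, G.Adj x y ∧ b x ≠ 0 ∧ b y ≠ 0 := by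
  classical
  constructor
  · rintro ⟨_, ⟨x, y, hxy, rfl⟩, hle⟩
    refine ⟨x, y, hxy, ?_, ?_⟩
    · have := hle x
      simp at this
      omega
    · have := hle y
      simp at this
      omega
  · rintro ⟨x, y, hxy, hx, hy⟩
    refine ⟨_, ⟨x, y, hxy, rfl⟩, fun z => ?_⟩
    have hne := hxy.ne
    simp only [Finsupp.add_apply, Finsupp.single_apply]
    split_ifs with h1 h2 h2
    · exact absurd (h1.trans h2.symm) hne
    · subst h1; omega
    · subst h2; omega
    · omega

lemma prod_X_eq_monomial {K ι : Type*} [Field K] (S : Finset ι) (g : ι → V) :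
    (∏ i ∈ S, X (g i) : MvPolynomial V K) = monomial (∑ i ∈ S, Finsupp.single (g i) 1) 1 := by
  rw [monomial_sum_one]
  rfl

variable {K : Type*} [Field K] [CharZero K]

theorem mem_secantIdeal_edgeIdeal {f : MvPolynomial V K} :
    f ∈ secantIdeal 2 (edgeIdeal K G) ↔
      ∀ u ∈ f.support, ∃ N e, IsInducedOddCycle G N e ∧ ∀ t, u (e t) ≠ 0 := by
  classical
  rw [edgeIdeal, mem_secantIdeal_span_monomial]
  simp only [exists_edge_le_iff]
  refine forall₂_congr fun u _ => ⟨fun h => ?_, ?_⟩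
  · refine exists_isInducedOddCycle (U := {v | u v ≠ 0})
      (exists_isClosedWalk_of_not_colorable fun ⟨C⟩ => ?_)
    have hC : ∀ {x y} (hx : u x ≠ 0) (hy : u y ≠ 0), G.Adj x y → C ⟨x, hx⟩ ≠ C ⟨y, hy⟩ :=
      fun hx hy hxy => C.valid (by simpa using hxy)
    -- Split `u` along the two colour classes; neither part contains an edge.
    rcases h _ _ (Finsupp.filter_add_filter_not u fun v => ∃ h : u v ≠ 0, C ⟨v, h⟩ = 0) with
      ⟨x, y, hxy, hx, hy⟩ | ⟨x, y, hxy, hx, hy⟩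
    · simp only [Finsupp.filter_apply, ne_eq, ite_eq_right_iff, Classical.not_imp] at hx hy
      obtain ⟨⟨hx1, hx2⟩, -⟩ := hx
      obtain ⟨⟨hy1, hy2⟩, -⟩ := hy
      exact hC hx1 hy1 hxy (hx2.trans hy2.symm)
    · simp only [Finsupp.filter_apply, ne_eq, ite_eq_right_iff, Classical.not_imp, not_exists]
        at hx hy
      have hx1 := hx.1 hx.2
      have hy1 := hy.1 hy.2
      have := hC hx.2 hy.2 hxy
      omega
  · rintro ⟨N, e, he, hu⟩ b c rfl
    by_contra! hcon
    obtain ⟨hb, hc⟩ := hcon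
    -- Every vertex of the cycle lies in `b` or `c`, and neither contains an edge, so membership in
    -- `b` alternates along the cycle. Odd length forbids this.
    have hstep : ∀ t, b (e (t + 1)) ≠ 0 ↔ ¬ b (e t) ≠ 0 := by
      intro t
      have h1 := hb _ _ (he.adj t)
      have h2 := hc _ _ (he.adj t)
      have h3 := hu t
      have h4 := hu (t + 1)
      simp only [Finsupp.add_apply] at h3 h4
      constructor
      · exact fun h h' => h (h1 h')
      · intro h h'
        rw [not_not] at h
        exact h4 (by rw [h', h2 (by omega)])
    have := alternating_of_step (P := fun t => b (e t) ≠ 0) hstep he.odd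
    have h0 : e N = e 0 := by simpa using he.periodic 0
    simp only [h0] at this
    tauto

/-- The products of the variables in the vertices of an induced odd cycle. -/
def oddCycleMonomials (K : Type*) [Field K] (G : SimpleGraph V) : Set (MvPolynomial V K) :=
  {f | ∃ (S : Finset V) (N : ℕ) (e : ℕ → V), IsInducedOddCycle G N e ∧ (S : Set V) = Set.range e ∧
    f = ∏ v ∈ S, X v}

lemma sum_single_apply [DecidableEq V] (S : Finset V) (v : V) :
    (∑ i ∈ S, Finsupp.single i 1 : V →₀ ℕ) v = if v ∈ S then 1 else 0 := by
  simp [Finsupp.finsetSum_apply, Finsupp.single_apply]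

lemma sum_single_le_iff {S : Finset V} {u : V →₀ ℕ} :
    (∑ i ∈ S, Finsupp.single i 1 : V →₀ ℕ) ≤ u ↔ ∀ v ∈ S, u v ≠ 0 := by
  classical
  simp only [Finsupp.le_def, sum_single_apply]
  refine forall_congr' fun v => ?_
  by_cases h : v ∈ S
  · simp only [h, if_true, forall_const]; omega
  · simp [h]

lemma IsClosedWalk.finite_range {N : ℕ} {e : ℕ → V} (h : IsClosedWalk G N e) (hN : 0 < N) :
    (Set.range e).Finite := by
  refine (((Finset.range N).finite_toSet).image e).subset ?_
  rintro _ ⟨t, rfl⟩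
  exact ⟨t % N, by simpa using Nat.mod_lt t hN, h.periodic.map_mod_nat t⟩

lemma monomial_mem_secantIdeal_edgeIdeal {u : V →₀ ℕ} :
    (monomial u 1 : MvPolynomial V K) ∈ secantIdeal 2 (edgeIdeal K G) ↔
      ∃ (S : Finset V) (N : ℕ) (e : ℕ → V), IsInducedOddCycle G N e ∧ (S : Set V) = Set.range e ∧
        (∑ i ∈ S, Finsupp.single i 1 : V →₀ ℕ) ≤ u := by
  classical
  rw [mem_secantIdeal_edgeIdeal]
  simp only [support_monomial, one_ne_zero, if_false, Finset.mem_singleton, forall_eq]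
  constructor
  · rintro ⟨N, e, he, hu⟩
    have hfin := he.finite_range (by have := he.three_le; omega)
    refine ⟨hfin.toFinset, N, e, he, hfin.coe_toFinset, sum_single_le_iff.2 ?_⟩
    intro v hv
    obtain ⟨t, rfl⟩ := hfin.mem_toFinset.1 hv
    exact hu t
  · rintro ⟨S, N, e, he, hS, hle⟩
    refine ⟨N, e, he, fun t => sum_single_le_iff.1 hle _ ?_⟩
    rw [← Finset.mem_coe, hS]
    exact ⟨t, rfl⟩

theorem secantIdeal_edgeIdeal_eq_span :
    secantIdeal 2 (edgeIdeal K G) = Ideal.span (oddCycleMonomials K G) := by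
  have himg : oddCycleMonomials K G = (fun t => monomial t (1 : K)) ''
      {t | ∃ (S : Finset V) (N : ℕ) (e : ℕ → V), IsInducedOddCycle G N e ∧
        (S : Set V) = Set.range e ∧ t = ∑ i ∈ S, Finsupp.single i 1} := by
    ext f
    constructor
    · rintro ⟨S, N, e, he, hS, rfl⟩
      exact ⟨_, ⟨S, N, e, he, hS, rfl⟩, (prod_X_eq_monomial S id).symm⟩
    · rintro ⟨_, ⟨S, N, e, he, hS, rfl⟩, rfl⟩
      exact ⟨S, N, e, he, hS, (prod_X_eq_monomial S id).symm⟩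
  ext f
  rw [himg, mem_ideal_span_monomial_image, mem_secantIdeal_edgeIdeal]
  refine forall₂_congr fun u _ => ?_
  have := monomial_mem_secantIdeal_edgeIdeal (G := G) (K := K) (u := u)
  rw [mem_secantIdeal_edgeIdeal] at this
  classical
  simp only [support_monomial, one_ne_zero, if_false, Finset.mem_singleton, forall_eq] at this
  rw [this]
  constructor
  · rintro ⟨S, N, e, he, hS, hle⟩
    exact ⟨_, ⟨S, N, e, he, hS, rfl⟩, hle⟩
  · rintro ⟨_, ⟨S, N, e, he, hS, rfl⟩, hle⟩
    exact ⟨S, N, e, he, hS, hle⟩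

/-- Removing a vertex from an induced odd cycle leaves no closed walk of odd length. -/
lemma IsInducedOddCycle.not_odd_of_forall_ne {N : ℕ} {e : ℕ → V} (he : IsInducedOddCycle G N e)
    {M : ℕ} {e' : ℕ → V} (he' : IsClosedWalk G M e') (hrange : ∀ t, e' t ∈ Set.range e) {s : ℕ}
    (hs : ∀ t, e' t ≠ e s) : ¬ Odd M := by
  intro hM
  have hN := he.three_le
  have hex : ∀ x, x ∈ Set.range e → x ≠ e s → ∃ j, 1 ≤ j ∧ j < N ∧ e (s + j) = x := by
    rintro _ ⟨r, rfl⟩ hne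
    -- The offset is `r - s` modulo `N`, written without subtraction.
    have hc : e (s + (r + (N - 1) * s) % N) = e r := by
      refine eq_of_modEq_of_periodic he.periodic ?_
      refine ((Nat.mod_modEq _ N).add_left s).trans ?_
      obtain ⟨m, rfl⟩ : ∃ m, N = m + 1 := ⟨N - 1, by omega⟩
      rw [Nat.add_sub_cancel, show s + (r + m * s) = r + (m + 1) * s by ring]
      simp [Nat.ModEq]
    refine ⟨_, ?_, Nat.mod_lt _ (by omega), hc⟩
    by_contra h0
    rw [Nat.lt_one_iff.1 (not_le.1 h0), add_zero] at hc
    exact hne hc.symm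
  choose! j hj1 hjN hj using hex
  have hadj : ∀ a b, 1 ≤ a → a < b → b < N → G.Adj (e (s + a)) (e (s + b)) → b = a + 1 := by
    intro a b ha hab hb h
    by_contra hne
    refine he.not_adj (s + a) (b - a) (by omega) (by omega) ?_
    rwa [show s + a + (b - a) = s + b by omega]
  -- What remains of the cycle is a path, on which the parity of the position `j` is a 2-colouring.
  have hstep : ∀ t, Even (j (e' (t + 1))) ↔ ¬ Even (j (e' t)) := by
    intro t
    have h1 := he'.adj t
    have ha := hj1 _ (hrange t) (hs t)
    have ha' := hj1 _ (hrange (t + 1)) (hs (t + 1))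
    have hb := hjN _ (hrange t) (hs t)
    have hb' := hjN _ (hrange (t + 1)) (hs (t + 1))
    have hc := hj _ (hrange t) (hs t)
    have hc' := hj _ (hrange (t + 1)) (hs (t + 1))
    rw [← hc, ← hc'] at h1
    rcases lt_trichotomy (j (e' t)) (j (e' (t + 1))) with h | h | h
    · rw [hadj _ _ ha h hb' h1, Nat.even_add_one]
    · rw [h] at h1
      exact absurd h1 G.irrefl
    · rw [hadj _ _ ha' h hb h1.symm, Nat.even_add_one, not_not]
  have := alternating_of_step (P := fun t => Even (j (e' t))) hstep hM
  have h0 : e' M = e' 0 := by simpa using he'.periodic 0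
  simp only [h0] at this
  tauto

theorem minimalGenerators_secantIdeal_edgeIdeal :
    minimalGenerators (secantIdeal 2 (edgeIdeal K G)) = oddCycleMonomials K G := by
  classical
  ext f
  constructor
  · rintro ⟨u, rfl, hu, hmin⟩
    obtain ⟨S, N, e, he, hS, hle⟩ := monomial_mem_secantIdeal_edgeIdeal.1 hu
    refine ⟨S, N, e, he, hS, ?_⟩
    rcases hle.lt_or_eq with hlt | rfl
    · exact absurd (monomial_mem_secantIdeal_edgeIdeal.2 ⟨S, N, e, he, hS, le_rfl⟩) (hmin _ hlt)
    · exact (prod_X_eq_monomial S id).symm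
  · rintro ⟨S, N, e, he, hS, rfl⟩
    refine ⟨_, prod_X_eq_monomial S id, ?_, ?_⟩
    · rw [prod_X_eq_monomial S fun v => v]
      exact monomial_mem_secantIdeal_edgeIdeal.2 ⟨S, N, e, he, hS, le_rfl⟩
    · intro t ht hmem
      obtain ⟨S', N', e', he', hS', hle'⟩ := monomial_mem_secantIdeal_edgeIdeal.1 hmem
      have hsub : ∀ v ∈ S', v ∈ S := by
        intro v hv
        have h1 := sum_single_le_iff.1 (hle'.trans ht.le) v hv
        simp only [id, sum_single_apply] at h1
        by_contra h2
        simp [h2] at h1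
      obtain ⟨v, hv, hv'⟩ : ∃ v ∈ S, v ∉ S' := by
        by_contra! hcon
        have : S = S' := Finset.Subset.antisymm hcon hsub
        subst this
        exact absurd hle' (not_le_of_gt ht)
      rw [← Finset.mem_coe, hS] at hv
      obtain ⟨s, rfl⟩ := hv
      refine he.not_odd_of_forall_ne he'.toIsClosedWalk (s := s) (fun r => ?_) (fun r h => ?_)
        he'.odd
      · rw [← hS]
        apply hsub
        rw [← Finset.mem_coe, hS']
        exact ⟨r, rfl⟩
      · apply hv'
        rw [← Finset.mem_coe, hS', ← h]
        exact ⟨r, rfl⟩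

end OddCycles

/-! ### Lifts of edges to the universal cover of the circle -/

section Lifts

variable {n : ℕ}

lemma coe_steps (p v : Fin n) : (steps p v : ℤ) = (v.val - p.val : ℤ) % n := by
  rw [steps, Fin.sub_def]
  have := p.isLt
  push_cast [Nat.cast_sub this.le]
  rw [show (n - p.val + v.val : ℤ) = v.val - p.val + n by ring, Int.add_emod_right]

lemma steps_lt (p v : Fin n) : steps p v < n := (v - p).isLt

variable [NeZero n]

/-- The vertex under an integer, the integers being wound around the circle. -/
def vertex (n : ℕ) [NeZero n] (z : ℤ) : Fin n :=
  ⟨(z % n).toNat, by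
    have h : (0 : ℤ) < n := by exact_mod_cast Nat.pos_of_neZero n
    have h1 := Int.emod_nonneg z h.ne'
    have h2 := Int.emod_lt_of_pos z h
    omega⟩

lemma coe_vertex (z : ℤ) : ((vertex n z).val : ℤ) = z % n := by
  have h : (n : ℤ) ≠ 0 := by exact_mod_cast NeZero.ne n
  exact Int.toNat_of_nonneg (Int.emod_nonneg z h)

lemma vertex_eq_iff {a b : ℤ} : vertex n a = vertex n b ↔ ∃ q : ℤ, b = a + q * n := by
  rw [Fin.ext_iff, ← Int.natCast_inj, coe_vertex, coe_vertex]
  change a ≡ b [ZMOD n] ↔ _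
  rw [Int.modEq_iff_dvd]
  constructor
  · rintro ⟨q, hq⟩
    exact ⟨q, by linarith [mul_comm (n : ℤ) q]⟩
  · rintro ⟨q, rfl⟩
    exact ⟨q, by ring⟩

lemma vertex_val (v : Fin n) : vertex n (v.val : ℤ) = v := by
  rw [Fin.ext_iff, ← Int.natCast_inj, coe_vertex]
  exact Int.emod_eq_of_lt (by positivity) (by exact_mod_cast v.isLt)

lemma vertex_add_mul (z q : ℤ) : vertex n (z + q * n) = vertex n z :=
  (vertex_eq_iff.2 ⟨q, rfl⟩).symm

lemma coe_steps_vertex (a b : ℤ) : (steps (vertex n a) (vertex n b) : ℤ) = (b - a) % n := by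
  rw [coe_steps, coe_vertex, coe_vertex, ← Int.sub_emod]

lemma vertex_add_steps (p v : Fin n) : vertex n (p.val + steps p v) = v := by
  rw [Fin.ext_iff, ← Int.natCast_inj, coe_vertex, coe_steps, Int.add_emod_emod,
    add_sub_cancel]
  exact Int.emod_eq_of_lt (by positivity) (by exact_mod_cast v.isLt)

lemma eq_zero_of_mul_lt {n q : ℤ} (h1 : -n < q * n) (h2 : q * n < n) : q = 0 := by
  have hn : 0 < n := by linarith
  have h3 : q < 1 := by nlinarith
  have h4 : -1 < q := by nlinarith
  omega

/-- The edge `e` joins the vertices under `α` and `β`, where `α < β < α + n`. -/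
structure IsLift (e : Edge n) (α β : ℤ) : Prop where
  lt : α < β
  lt_add : β < α + n
  eq : e.1 = s(vertex n α, vertex n β)

namespace IsLift

variable {e f : Edge n} {α β α' β' : ℤ}

lemma add_mul (h : IsLift e α β) (q : ℤ) : IsLift e (α + q * n) (β + q * n) :=
  ⟨by linarith [h.lt], by linarith [h.lt_add], by rw [vertex_add_mul, vertex_add_mul, h.eq]⟩

lemma flip (h : IsLift e α β) : IsLift e β (α + n) :=
  ⟨h.lt_add, by linarith [h.lt], by
    rw [h.eq, Sym2.eq_swap]
    have := vertex_add_mul (n := n) α 1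
    rw [one_mul] at this
    rw [this]⟩

lemma edge_eq (he : IsLift e α β) (hf : IsLift f α β) : e = f :=
  Subtype.ext (he.eq.trans hf.eq.symm)

lemma vertex_ne (h1 : α < β) (h2 : β < α + n) : vertex n α ≠ vertex n β := by
  intro h
  obtain ⟨q, hq⟩ := vertex_eq_iff.1 h
  have := eq_zero_of_mul_lt (n := n) (q := q) (by linarith) (by linarith)
  subst this
  linarith

lemma exists_edge (h1 : α < β) (h2 : β < α + n) : ∃ e : Edge n, IsLift e α β :=
  ⟨⟨s(vertex n α, vertex n β), by simpa using vertex_ne h1 h2⟩, h1, h2, rfl⟩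

lemma X_eq (h : IsLift e α β) : (X e : MvPolynomial (Edge n) ℂ) = x (vertex n α) (vertex n β) := by
  rw [x, dif_neg (vertex_ne h.lt h.lt_add)]
  congr 1
  exact Subtype.ext h.eq

/-- A chord cuts off two arcs, and its lifts form one orbit under translation by `n` for each of
them. -/
lemma cases (h : IsLift e α β) (h' : IsLift e α' β') :
    ∃ q : ℤ, (α' = α + q * n ∧ β' = β + q * n) ∨ (α' = β + q * n ∧ β' = α + n + q * n) := by
  have heq := h.eq.symm.trans h'.eq
  have := h.lt; have := h.lt_add; have := h'.lt; have := h'.lt_add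
  rw [Sym2.eq_iff] at heq
  rcases heq with ⟨h1, h2⟩ | ⟨h1, h2⟩
  · obtain ⟨q, hq⟩ := vertex_eq_iff.1 h1
    obtain ⟨r, hr⟩ := vertex_eq_iff.1 h2
    have h0 := eq_zero_of_mul_lt (n := n) (q := r - q) (by linarith [sub_mul r q (n : ℤ)])
      (by linarith [sub_mul r q (n : ℤ)])
    obtain rfl : r = q := by omega
    exact ⟨r, Or.inl ⟨hq, hr⟩⟩
  · obtain ⟨q, hq⟩ := vertex_eq_iff.1 h1
    obtain ⟨r, hr⟩ := vertex_eq_iff.1 h2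
    have h0 := eq_zero_of_mul_lt (n := n) (q := q - r - 1)
      (by linarith [sub_mul (q - r) 1 (n : ℤ), sub_mul q r (n : ℤ)])
      (by linarith [sub_mul (q - r) 1 (n : ℤ), sub_mul q r (n : ℤ)])
    obtain rfl : q = r + 1 := by omega
    exact ⟨r, Or.inr ⟨hr, by rw [hq]; ring⟩⟩

lemma edgeClass_eq (h : IsLift e α β) : (edgeClass e : ℤ) = min (β - α) (n - (β - α)) := by
  have := h.lt; have := h.lt_add
  rw [edgeClass, h.eq, Sym2.lift_mk]
  push_cast
  rw [coe_steps_vertex, coe_steps_vertex, Int.emod_eq_of_lt (by linarith) (by linarith)]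
  congr 1
  rw [← Int.add_emod_right, Int.emod_eq_of_lt (by linarith) (by linarith)]
  ring

end IsLift

lemma isLift_inf_sup (e : Edge n) : IsLift e (e.1.inf.val) (e.1.sup.val) := by
  obtain ⟨s, hs⟩ := e
  induction s using Sym2.ind with
  | _ a b =>
    have hab : a ≠ b := by simpa using hs
    rcases lt_or_gt_of_ne hab with h | h
    · refine ⟨?_, ?_, ?_⟩
      · simpa [inf_eq_left.2 h.le, sup_eq_right.2 h.le] using h
      · have := b.isLt
        simp only [Sym2.inf_mk, Sym2.sup_mk, inf_eq_left.2 h.le, sup_eq_right.2 h.le]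
        omega
      · simp [inf_eq_left.2 h.le, sup_eq_right.2 h.le, vertex_val]
    · refine ⟨?_, ?_, ?_⟩
      · simpa [inf_eq_right.2 h.le, sup_eq_left.2 h.le] using h
      · have := a.isLt
        simp only [Sym2.inf_mk, Sym2.sup_mk, inf_eq_right.2 h.le, sup_eq_left.2 h.le]
        omega
      · simp [inf_eq_right.2 h.le, sup_eq_left.2 h.le, vertex_val, Sym2.eq_swap]

/-- The graph on the edges of the `n`-gon in which two edges are adjacent when they have no common
point, as closed segments in the plane. -/
def disjointnessGraph (n : ℕ) [NeZero n] : SimpleGraph (Edge n) where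
  Adj e f := ∃ α β α' β' : ℤ, IsLift e α β ∧ IsLift f α' β' ∧ β < α' ∧ β' < α + n
  symm := ⟨by
    rintro e f ⟨α, β, α', β', he, hf, h1, h2⟩
    exact ⟨α', β', α + n, β + n, hf, by simpa using he.add_mul 1, h2, by linarith⟩⟩
  loopless := ⟨by
    rintro e ⟨α, β, α', β', he, hf, h1, h2⟩
    have := he.lt; have := hf.lt
    obtain ⟨q, ⟨rfl, rfl⟩ | ⟨rfl, rfl⟩⟩ := he.cases hf
    · have := eq_zero_of_mul_lt (n := n) (q := q) (by linarith) (by linarith)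
      subst this
      linarith
    · have := eq_zero_of_mul_lt (n := n) (q := q) (by linarith) (by linarith)
      subst this
      linarith⟩

end Lifts

/-! ### The initial ideal of the toric ideal -/

section Initial

variable {n : ℕ}

/-- The vertex degrees of an edge. -/
noncomputable def edgeDegree (e : Edge n) : Fin n →₀ ℕ :=
  Sym2.lift ⟨fun i j => Finsupp.single i 1 + Finsupp.single j 1, fun _ _ => add_comm _ _⟩ e.1

/-- The vertex degrees of a multigraph. -/
noncomputable def vertexDegree (u : Edge n →₀ ℕ) : Fin n →₀ ℕ := ∑ e, u e • edgeDegree e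

lemma phi_X (e : Edge n) : phi n (X e) = monomial (edgeDegree e) 1 := by
  obtain ⟨s, hs⟩ := e
  induction s using Sym2.ind with
  | _ a b =>
    rw [phi, aeval_X]
    change (X a * X b : MvPolynomial (Fin n) ℂ) =
      monomial (Finsupp.single a 1 + Finsupp.single b 1) 1
    rw [X, X, monomial_mul, one_mul]

lemma phi_monomial (u : Edge n →₀ ℕ) (c : ℂ) :
    phi n (monomial u c) = monomial (vertexDegree u) c := by
  have h : ∀ e, (aeval (R := ℂ) fun e : Edge n =>
      Sym2.mul (e.1.map fun i => (X i : MvPolynomial (Fin n) ℂ))) (X e) =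
      monomial (edgeDegree e) 1 := phi_X
  simp only [aeval_X] at h
  rw [phi, aeval_monomial, Finsupp.prod_fintype _ _ (by simp)]
  simp only [h, monomial_pow, one_pow]
  rw [← monomial_sum_one, algebraMap_eq, C_mul_monomial, mul_one]
  rfl

lemma vertexDegree_add (u v : Edge n →₀ ℕ) :
    vertexDegree (u + v) = vertexDegree u + vertexDegree v := by
  simp [vertexDegree, add_smul, Finset.sum_add_distrib]

lemma vertexDegree_single (e : Edge n) : vertexDegree (Finsupp.single e 1) = edgeDegree e := by
  classical
  rw [vertexDegree, Finset.sum_eq_single e]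
  · simp
  · intro f _ hf
    simp [hf.symm]
  · simp

lemma coeff_phi (f : MvPolynomial (Edge n) ℂ) (d : Fin n →₀ ℕ) :
    coeff d (phi n f) = ∑ u ∈ f.support, if vertexDegree u = d then coeff u f else 0 := by
  classical
  conv_lhs => rw [f.as_sum, map_sum, coeff_sum]
  simp only [phi_monomial, coeff_monomial]

lemma sum_vertexDegree (u : Edge n →₀ ℕ) (T : Finset (Fin n)) :
    ∑ i ∈ T, vertexDegree u i =
      (∑ e with e.1.inf ∈ T, u e) + ∑ e with e.1.sup ∈ T, u e := by
  have h : ∀ (e : Edge n) (i : Fin n), edgeDegree e i =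
      (if e.1.inf = i then 1 else 0) + if e.1.sup = i then 1 else 0 := by
    rintro ⟨s, hs⟩ i
    induction s using Sym2.ind with
    | _ a b =>
      change (Finsupp.single a 1 + Finsupp.single b 1 : Fin n →₀ ℕ) i =
        (if min a b = i then 1 else 0) + if max a b = i then 1 else 0
      simp only [Finsupp.add_apply, Finsupp.single_apply]
      rcases le_total a b with hab | hab
      · rw [min_eq_left hab, max_eq_right hab]
      · rw [min_eq_right hab, max_eq_left hab, add_comm]
  simp only [vertexDegree, Finsupp.finsetSum_apply, Finsupp.smul_apply, smul_eq_mul, h]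
  rw [Finset.sum_comm, Finset.sum_filter, Finset.sum_filter, ← Finset.sum_add_distrib]
  refine Finset.sum_congr rfl fun e _ => ?_
  simp only [mul_add, Finset.sum_add_distrib, mul_ite, mul_one, mul_zero, Finset.sum_ite_eq]

variable [NeZero n]

/-- Cutting the circle between `n - 1` and `0` turns chords into intervals. Chords that meet become
intervals that meet and are not strictly nested; the second half is `not_nested_of_not_adj`. -/
lemma inf_le_sup_of_not_adj {e f : Edge n} (h : ¬ (disjointnessGraph n).Adj e f) :
    e.1.inf ≤ f.1.sup := by
  by_contra hlt
  refine h (SimpleGraph.Adj.symm ⟨_, _, _, _, isLift_inf_sup f, isLift_inf_sup e, ?_, ?_⟩)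
  · exact_mod_cast not_le.1 hlt
  · have := e.1.sup.isLt
    omega

lemma not_nested_of_not_adj {e f : Edge n} (h : ¬ (disjointnessGraph n).Adj e f)
    (h1 : e.1.inf < f.1.inf) : e.1.sup ≤ f.1.sup := by
  by_contra hlt
  refine h ⟨_, _, _, _, (isLift_inf_sup e).flip, (isLift_inf_sup f).add_mul 1, ?_, ?_⟩
  · have := e.1.sup.isLt
    omega
  · have : f.1.sup.val < e.1.sup.val := not_le.1 hlt
    omega

/-- A multigraph without disjoint edges is determined by its vertex degrees. -/
lemma eq_of_vertexDegree_eq {u v : Edge n →₀ ℕ}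
    (hu : ∀ e f, u e ≠ 0 → u f ≠ 0 → ¬ (disjointnessGraph n).Adj e f)
    (hv : ∀ e f, v e ≠ 0 → v f ≠ 0 → ¬ (disjointnessGraph n).Adj e f)
    (huv : vertexDegree u = vertexDegree v) : u = v := by
  have hle : ∀ (u : Edge n →₀ ℕ) (P Q : Edge n → Prop) [DecidablePred P] [DecidablePred Q],
      (∀ e, u e ≠ 0 → P e → Q e) → (∑ e with P e, u e) ≤ ∑ e with Q e, u e := by
    intro u P Q _ _ h
    rw [Finset.sum_filter, Finset.sum_filter]
    refine Finset.sum_le_sum fun e _ => ?_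
    by_cases h0 : u e = 0
    · simp [h0]
    · have := h e h0
      split_ifs <;> first | tauto | exact Nat.zero_le _
  have hinfsup : ∀ (e : Edge n) p, e.1.sup ≤ p → e.1.inf ≤ p := fun e p h =>
    (Sym2.inf_le_sup e.1).trans h
  -- All lower ends precede all upper ends. Hence the lower ends are the smaller half of the vertex
  -- degrees counted with multiplicity, and `hAB` can recover both distributions from the degrees.
  have hA : ∀ u : Edge n →₀ ℕ, (∀ e f, u e ≠ 0 → u f ≠ 0 → ¬ (disjointnessGraph n).Adj e f) →
      ∀ p : Fin n, (∑ e with e.1.inf ≤ p, u e) = ∑ e, u e ∨ (∑ e with e.1.sup ≤ p, u e) = 0 := by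
    intro u hu p
    by_cases hex : ∃ e, u e ≠ 0 ∧ ¬ e.1.inf ≤ p
    · obtain ⟨e, he, hep⟩ := hex
      right
      refine Finset.sum_eq_zero fun f hf => ?_
      by_contra h0
      exact hep ((inf_le_sup_of_not_adj (hu e f he h0)).trans (Finset.mem_filter.1 hf).2)
    · push Not at hex
      left
      rw [Finset.sum_filter]
      refine Finset.sum_congr rfl fun e _ => ?_
      by_cases h0 : u e = 0
      · simp [h0]
      · rw [if_pos (hex e h0)]
  have hd : ∑ e, u e = ∑ e, v e := by
    have h1 := sum_vertexDegree u Finset.univ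
    have h2 := sum_vertexDegree v Finset.univ
    rw [huv] at h1
    simp only [Finset.mem_univ, Finset.filter_true] at h1 h2
    omega
  have hAB : ∀ p : Fin n, (∑ e with e.1.inf ≤ p, u e) = (∑ e with e.1.inf ≤ p, v e) ∧
      (∑ e with e.1.sup ≤ p, u e) = ∑ e with e.1.sup ≤ p, v e := by
    intro p
    have h1 := sum_vertexDegree u (Finset.Iic p)
    have h2 := sum_vertexDegree v (Finset.Iic p)
    rw [huv] at h1
    simp only [Finset.mem_Iic] at h1 h2
    have h3 := hA u hu p
    have h4 := hA v hv p
    have h5 := hle u _ _ fun e _ => hinfsup e p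
    have h6 := hle v _ _ fun e _ => hinfsup e p
    have h7 := hle u (fun e => e.1.inf ≤ p) (fun _ => True) fun _ _ _ => trivial
    have h8 := hle v (fun e => e.1.inf ≤ p) (fun _ => True) fun _ _ _ => trivial
    simp only [Finset.filter_true] at h7 h8
    omega
  -- Without nesting, lower and upper ends are matched monotonically, so the joint count is the
  -- minimum of the two marginal counts.
  have hM : ∀ u : Edge n →₀ ℕ, (∀ e f, u e ≠ 0 → u f ≠ 0 → ¬ (disjointnessGraph n).Adj e f) →
      ∀ p q : Fin n, (∑ e with e.1.inf ≤ p ∧ e.1.sup ≤ q, u e) =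
        min (∑ e with e.1.inf ≤ p, u e) (∑ e with e.1.sup ≤ q, u e) := by
    intro u hu p q
    have h1 := hle u (fun e => e.1.inf ≤ p ∧ e.1.sup ≤ q) (fun e => e.1.inf ≤ p) fun _ _ h => h.1
    have h2 := hle u (fun e => e.1.inf ≤ p ∧ e.1.sup ≤ q) (fun e => e.1.sup ≤ q) fun _ _ h => h.2
    by_cases hex : ∃ e, u e ≠ 0 ∧ e.1.inf ≤ p ∧ ¬ e.1.sup ≤ q
    · obtain ⟨e, he, hep, heq⟩ := hex
      have h3 := hle u (fun e => e.1.sup ≤ q) (fun e => e.1.inf ≤ p ∧ e.1.sup ≤ q)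
        fun f hf hfq => ⟨by
          by_contra hfp
          exact heq ((not_nested_of_not_adj (hu e f he hf) (hep.trans_lt (not_le.1 hfp))).trans
            hfq), hfq⟩
      omega
    · push Not at hex
      have h3 := hle u (fun e => e.1.inf ≤ p) (fun e => e.1.inf ≤ p ∧ e.1.sup ≤ q)
        fun f hf hfp => ⟨hfp, hex f hf hfp⟩
      omega
  ext e
  -- Single multiplicities are recovered from the cumulative counts `hM`, the intervals with both
  -- ends smaller or equal being known already.
  induction hk : e.1.inf.val + e.1.sup.val using Nat.strong_induction_on generalizing e with
  | _ k ih =>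
    have h := hM u hu e.1.inf e.1.sup
    rw [(hAB _).1, (hAB _).2, ← hM v hv] at h
    have hmem : e ∈ ({f | f.1.inf ≤ e.1.inf ∧ f.1.sup ≤ e.1.sup} : Finset (Edge n)) := by simp
    rw [← Finset.add_sum_erase _ _ hmem, ← Finset.add_sum_erase _ _ hmem] at h
    refine Nat.add_right_cancel (h.trans ?_)
    congr 1
    refine Finset.sum_congr rfl fun f hf => (ih _ ?_ f rfl).symm
    rw [Finset.mem_erase, Finset.mem_filter] at hf
    obtain ⟨hne, -, h1, h2⟩ := hf
    have h1' : f.1.inf.val ≤ e.1.inf.val := h1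
    have h2' : f.1.sup.val ≤ e.1.sup.val := h2
    by_contra hlt
    refine hne (Subtype.ext (Sym2.inf_eq_inf_and_sup_eq_sup.1 ⟨Fin.ext ?_, Fin.ext ?_⟩)) <;> omega

/-- Two disjoint edges can be replaced by two crossing edges with the same ends; this makes the
monomial smaller in a circular term order. -/
lemma exists_smaller_of_adj {m : MonomialOrder (Edge n)} (hm : IsCircular m) {e f : Edge n}
    (h : (disjointnessGraph n).Adj e f) : ∃ g k : Edge n,
      edgeDegree g + edgeDegree k = edgeDegree e + edgeDegree f ∧
      m.toSyn (Finsupp.single g 1 + Finsupp.single k 1) <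
        m.toSyn (Finsupp.single e 1 + Finsupp.single f 1) := by
  classical
  obtain ⟨α, β, α', β', he, hf, h1, h2⟩ := h
  have := he.lt; have := hf.lt
  obtain ⟨g, hg⟩ := IsLift.exists_edge (n := n) (show α < α' by omega) (by omega)
  obtain ⟨k, hk⟩ := IsLift.exists_edge (n := n) (show β < β' by omega) (by omega)
  have hdeg : ∀ {e : Edge n} {α β : ℤ}, IsLift e α β → edgeDegree e =
      Finsupp.single (vertex n α) 1 + Finsupp.single (vertex n β) 1 := fun h => by
    rw [edgeDegree, h.eq, Sym2.lift_mk]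
  refine ⟨g, k, by rw [hdeg he, hdeg hf, hdeg hg, hdeg hk]; abel, ?_⟩
  have ce := he.edgeClass_eq
  have cf := hf.edgeClass_eq
  have cg := hg.edgeClass_eq
  have ck := hk.edgeClass_eq
  -- Each of the two arcs of `g`, and each of the two arcs of `k`, strictly contains an arc of `e`
  -- or of `f`.
  have hg1 : min (edgeClass e) (edgeClass f) < edgeClass g := by omega
  have hk1 : min (edgeClass e) (edgeClass f) < edgeClass k := by omega
  have hz : ∀ {g k d : Edge n}, edgeClass d < edgeClass g → edgeClass d < edgeClass k →
      (Finsupp.single g 1 + Finsupp.single k 1 : Edge n →₀ ℕ) d = 0 := by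
    intro g k d h1 h2
    have h3 : g ≠ d := by rintro rfl; omega
    have h4 : k ≠ d := by rintro rfl; omega
    simp [h3, h4]
  refine hm (min (edgeClass e) (edgeClass f)) _ _ (fun d hd => ?_) ?_
  · rw [hz (by omega) (by omega), hz (by omega) (by omega)]
  · have h0 : ((Finsupp.single g 1 + Finsupp.single k 1 : Edge n →₀ ℕ).filter
        fun d => edgeClass d = min (edgeClass e) (edgeClass f)) = 0 := by
      rw [Finsupp.filter_eq_zero_iff]
      intro d hd
      exact hz (by omega) (by omega)
    rw [h0, map_zero, MonomialOrder.toSyn_lt_iff_ne_zero, ne_eq, MonomialOrder.toSyn_eq_zero_iff,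
      Finsupp.filter_eq_zero_iff]
    intro hall
    rcases min_choice (edgeClass e) (edgeClass f) with h | h
    · have := hall e h.symm
      simp at this
    · have := hall f h.symm
      simp at this

/-- A multigraph without disjoint edges gives the smallest monomial among those with the same
vertex degrees. -/
lemma toSyn_le_of_vertexDegree_eq {m : MonomialOrder (Edge n)} (hm : IsCircular m)
    {u : Edge n →₀ ℕ} (hu : ∀ e f, u e ≠ 0 → u f ≠ 0 → ¬ (disjointnessGraph n).Adj e f)
    (v : Edge n →₀ ℕ) (huv : vertexDegree v = vertexDegree u) : m.toSyn u ≤ m.toSyn v := by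
  classical
  -- Exchanging disjoint pairs for crossing ones descends in a well-order; it can only stop at `u`,
  -- by uniqueness.
  induction hs : m.toSyn v using WellFoundedLT.induction generalizing v with
  | ind s ih =>
    subst hs
    by_cases hv : ∀ e f, v e ≠ 0 → v f ≠ 0 → ¬ (disjointnessGraph n).Adj e f
    · rw [eq_of_vertexDegree_eq hv hu huv]
    · push Not at hv
      obtain ⟨e, f, he, hf, hef⟩ := hv
      obtain ⟨g, k, hdeg, hlt⟩ := exists_smaller_of_adj hm hef
      obtain ⟨w, rfl⟩ : ∃ w, v = w + (Finsupp.single e 1 + Finsupp.single f 1) := by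
        have hle : Finsupp.single e 1 + Finsupp.single f 1 ≤ v := by
          intro d
          have hne := hef.ne
          simp only [Finsupp.add_apply, Finsupp.single_apply]
          split_ifs with h1 h2 h2
          · exact absurd (h1.trans h2.symm) hne
          · subst h1; omega
          · subst h2; omega
          · omega
        exact ⟨_, (tsub_add_cancel_of_le hle).symm⟩
      have hlt' : m.toSyn (w + (Finsupp.single g 1 + Finsupp.single k 1)) <
          m.toSyn (w + (Finsupp.single e 1 + Finsupp.single f 1)) := by
        rw [map_add, map_add m.toSyn w]
        exact add_lt_add_right hlt _
      refine (ih _ hlt' _ ?_ rfl).trans hlt'.le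
      rw [← huv]
      simp only [vertexDegree_add, vertexDegree_single, hdeg]

/-- The initial ideal of the toric ideal of the second hypersimplex. -/
theorem initialIdeal_toricIdeal {m : MonomialOrder (Edge n)} (hm : IsCircular m) :
    initialIdeal m (toricIdeal n) = edgeIdeal ℂ (disjointnessGraph n) := by
  classical
  apply le_antisymm
  · refine Ideal.span_le.2 ?_
    rintro _ ⟨f, hf, rfl⟩
    rcases eq_or_ne f 0 with rfl | hf0
    · simp
    · rw [SetLike.mem_coe, edgeIdeal, mem_ideal_span_monomial_image]
      intro u hu
      rw [MonomialOrder.leadingTerm] at hu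
      obtain rfl := Finset.mem_singleton.1 (support_monomial_subset hu)
      rw [exists_edge_le_iff]
      by_contra! hcon
      have hstd : ∀ e f', m.degree f e ≠ 0 → m.degree f f' ≠ 0 →
          ¬ (disjointnessGraph n).Adj e f' := fun e f' h1 h2 h3 => h2 (hcon e f' h3 h1)
      -- Any other monomial of `f` with these vertex degrees would be both below and above the
      -- leading one, so the leading coefficient cannot cancel in `phi n f`.
      have h0 : coeff (vertexDegree (m.degree f)) (phi n f) = 0 := by
        rw [show phi n f = 0 from hf, coeff_zero]
      rw [coeff_phi, Finset.sum_eq_single (m.degree f), if_pos rfl] at h0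
      · exact MonomialOrder.coeff_degree_ne_zero_iff.2 hf0 h0
      · intro v hv hne
        rw [if_neg]
        intro hdeg
        refine hne (m.toSyn.injective (le_antisymm (m.le_degree hv) ?_))
        exact toSyn_le_of_vertexDegree_eq hm hstd v hdeg
      · intro h
        exact absurd (m.degree_mem_support hf0) h
  · refine Ideal.span_le.2 ?_
    rintro _ ⟨_, ⟨e, f, hef, rfl⟩, rfl⟩
    obtain ⟨g, k, hdeg, hlt⟩ := exists_smaller_of_adj hm hef
    have hlt' : m.toSyn (m.degree (monomial (Finsupp.single g 1 + Finsupp.single k 1) (1 : ℂ))) <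
        m.toSyn (m.degree (monomial (Finsupp.single e 1 + Finsupp.single f 1) (1 : ℂ))) := by
      simpa [MonomialOrder.degree_monomial] using hlt
    refine Ideal.subset_span ⟨monomial (Finsupp.single e 1 + Finsupp.single f 1) 1 -
      monomial (Finsupp.single g 1 + Finsupp.single k 1) 1, ?_, ?_⟩
    · change phi n _ = 0
      rw [map_sub, phi_monomial, phi_monomial, vertexDegree_add, vertexDegree_add]
      simp only [vertexDegree_single, hdeg, sub_self]
    · rw [MonomialOrder.leadingTerm, MonomialOrder.degree_sub_of_lt hlt',
        MonomialOrder.leadingCoeff_sub_of_lt hlt', MonomialOrder.leadingCoeff_monomial,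
        MonomialOrder.degree_monomial, if_neg one_ne_zero]

end Initial

/-! ### Adjacency in terms of lifts -/

section Adjacency

variable {n : ℕ} [NeZero n] {e f : Edge n} {α β α' β' : ℤ}

lemma IsLift.adj_of_nested (he : IsLift e α β) (hf : IsLift f α' β') (h1 : α < α')
    (h2 : β' < β) : (disjointnessGraph n).Adj e f :=
  ⟨_, _, _, _, he.flip, by simpa using hf.add_mul 1, by linarith, by linarith⟩

lemma IsLift.cases_of_adj (he : IsLift e α β) (h : (disjointnessGraph n).Adj e f) :
    ∃ α' β', IsLift f α' β' ∧ (β < α' ∧ β' < α + n ∨ α < α' ∧ β' < β) := by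
  obtain ⟨a, b, a', b', he', hf, h1, h2⟩ := h
  obtain ⟨q, ⟨rfl, rfl⟩ | ⟨rfl, rfl⟩⟩ := he.cases he'
  · exact ⟨_, _, hf.add_mul (-q), Or.inl ⟨by linarith, by linarith⟩⟩
  · exact ⟨_, _, hf.add_mul (-q - 1), Or.inr ⟨by linarith, by linarith⟩⟩

lemma IsLift.not_adj_of_crossing (he : IsLift e α β) (hf : IsLift f α' β') (h1 : α ≤ α')
    (h2 : α' ≤ β) (h3 : β ≤ β') (h4 : β' ≤ α + n) : ¬ (disjointnessGraph n).Adj e f := by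
  intro h
  obtain ⟨a, b, hab, h⟩ := he.cases_of_adj h
  have := he.lt; have := he.lt_add; have := hf.lt; have := hab.lt
  obtain ⟨q, ⟨rfl, rfl⟩ | ⟨rfl, rfl⟩⟩ := hf.cases hab <;> rcases h with ⟨h5, h6⟩ | ⟨h5, h6⟩ <;>
  · have := eq_zero_of_mul_lt (n := n) (q := q) (by linarith) (by linarith)
    subst this
    linarith

lemma IsLift.eq_of_window {x : ℤ} (h : IsLift e α β) (h' : IsLift e α' β') (h1 : x < α)
    (h2 : β < x + n) (h3 : x < α') (h4 : β' < x + n) : α' = α ∧ β' = β := by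
  have := h.lt; have := h'.lt
  obtain ⟨q, ⟨rfl, rfl⟩ | ⟨rfl, rfl⟩⟩ := h.cases h' <;>
  · have := eq_zero_of_mul_lt (n := n) (q := q) (by linarith) (by linarith)
    subst this
    constructor <;> linarith

lemma IsLift.ne_of_crossing (he : IsLift e α β) (hf : IsLift f α' β') (h1 : α < α')
    (h2 : β < β') (h3 : β' < α + n) : e ≠ f := by
  rintro rfl
  have := he.lt; have := hf.lt
  obtain ⟨q, ⟨rfl, rfl⟩ | ⟨rfl, rfl⟩⟩ := he.cases hf <;>
  · have := eq_zero_of_mul_lt (n := n) (q := q) (by linarith) (by linarith)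
    subst this
    linarith

lemma coe_steps_vertex_of_le {a b : ℤ} (h1 : a ≤ b) (h2 : b < a + n) :
    (steps (vertex n a) (vertex n b) : ℤ) = b - a := by
  rw [coe_steps_vertex, Int.emod_eq_of_lt (by linarith) (by linarith)]

end Adjacency

/-! ### Triangles -/

section Triangles

variable {n : ℕ} [NeZero n]

lemma circularlyIncreasing_vertex {m : ℕ} {z : Fin m → ℤ} (hz : StrictMono z) {c : ℤ}
    (h1 : ∀ a, c ≤ z a) (h2 : ∀ a, z a < c + n) :
    CircularlyIncreasing fun a => vertex n (z a) := by
  refine ⟨vertex n c, fun a b hab => ?_⟩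
  have ha := coe_steps_vertex_of_le (h1 a) (h2 a)
  have hb := coe_steps_vertex_of_le (h1 b) (h2 b)
  have := hz hab
  change steps (vertex n c) (vertex n (z a)) < steps (vertex n c) (vertex n (z b))
  omega

lemma exists_circularlyIncreasing {a b c d p q : ℤ} (h1 : a < b) (h2 : b < c) (h3 : c < d)
    (h4 : d < p) (h5 : p < q) (h6 : q < a + n) : CircularlyIncreasing
      ![vertex n a, vertex n b, vertex n c, vertex n d, vertex n p, vertex n q] := by
  have hz : StrictMono (![a, b, c, d, p, q] : Fin 6 → ℤ) := by
    refine Fin.strictMono_iff_lt_succ.2 fun i => ?_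
    fin_cases i <;> simp <;> assumption
  have hle : ∀ i, a ≤ (![a, b, c, d, p, q] : Fin 6 → ℤ) i := fun i => hz.monotone (Fin.zero_le i)
  have hlt : ∀ i, (![a, b, c, d, p, q] : Fin 6 → ℤ) i < a + n := fun i =>
    (hz.monotone (Fin.le_last i)).trans_lt h6
  convert circularlyIncreasing_vertex hz hle hlt with i
  fin_cases i <;> rfl

variable {e f g : Edge n} {a b c d p q : ℤ}

lemma mul_mem_tripleMonomials_of_consecutive (he : IsLift e a b) (hf : IsLift f c d)
    (hg : IsLift g p q) (h1 : b < c) (h2 : d < p) (h3 : q < a + n) :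
    (X e * X f * X g : MvPolynomial (Edge n) ℂ) ∈ tripleMonomials n := by
  refine ⟨_, exists_circularlyIncreasing he.lt h1 hf.lt h2 hg.lt h3, Or.inl ?_⟩
  rw [he.X_eq, hf.X_eq, hg.X_eq]
  rfl

lemma mul_mem_tripleMonomials_of_parallel (he : IsLift e a b) (hf : IsLift f c d)
    (hg : IsLift g p q) (h1 : a < c) (h2 : c < p) (h3 : q < d) (h4 : d < b) :
    (X e * X f * X g : MvPolynomial (Edge n) ℂ) ∈ tripleMonomials n := by
  refine ⟨_, exists_circularlyIncreasing h1 h2 hg.lt h3 h4 he.lt_add, Or.inr ?_⟩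
  rw [he.X_eq, hf.X_eq, hg.X_eq]
  rfl

/-- If `f` and `g` lie on the same side of `e`, they are side by side or one separates the other
from `e`. If they lie on different sides, `e` is the middle one of three parallel chords. -/
lemma mul_mem_tripleMonomials (hef : (disjointnessGraph n).Adj e f)
    (heg : (disjointnessGraph n).Adj e g) (hfg : (disjointnessGraph n).Adj f g) :
    (X e * X f * X g : MvPolynomial (Edge n) ℂ) ∈ tripleMonomials n := by
  obtain ⟨α, β, a, b, he, hf, h1, h2⟩ := hef
  obtain ⟨c, d, hg, ⟨h3, h4⟩ | ⟨h3, h4⟩⟩ := he.cases_of_adj heg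
  · have key : ∀ {f g : Edge n} {a b c d : ℤ}, IsLift f a b → IsLift g c d → β < a → b < α + n →
        β < c → d < α + n → (disjointnessGraph n).Adj f g → a ≤ c →
        (X e * X f * X g : MvPolynomial (Edge n) ℂ) ∈ tripleMonomials n := by
      intro f g a b c d hf hg h1 h2 h3 h4 hfg hac
      have := hf.lt; have := hg.lt; have := he.lt
      rcases lt_or_ge b c with h5 | h5
      · exact mul_mem_tripleMonomials_of_consecutive he hf hg h1 h5 h4
      · have h6 : d < b := by
          by_contra h
          exact hf.not_adj_of_crossing hg hac h5 (not_lt.1 h) (by linarith) hfg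
        have h7 : a < c := by
          by_contra h
          exact hg.not_adj_of_crossing hf (not_lt.1 h) (by linarith) h6.le (by linarith) hfg.symm
        exact mul_mem_tripleMonomials_of_parallel he.flip hf hg h1 h7 h6 h2
    rcases le_total a c with h | h
    · exact key hf hg h1 h2 h3 h4 hfg h
    · rw [mul_right_comm]
      exact key hg hf h3 h4 h1 h2 hfg.symm h
  · rw [mul_comm, ← mul_assoc]
    have := hg.lt
    exact mul_mem_tripleMonomials_of_parallel hg.flip he.flip hf h4 h1 h2 (by linarith)

lemma exists_adj_of_mem_tripleMonomials {f : MvPolynomial (Edge n) ℂ} (hf : f ∈ tripleMonomials n) :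
    ∃ a b c, (disjointnessGraph n).Adj a b ∧ (disjointnessGraph n).Adj a c ∧
      (disjointnessGraph n).Adj b c ∧ f = X a * X b * X c := by
  obtain ⟨v, ⟨p, hp⟩, hf⟩ := hf
  set z : Fin 6 → ℤ := fun a => p.val + steps p (v a) with hz
  have hv : ∀ a, v a = vertex n (z a) := fun a => (vertex_add_steps p (v a)).symm
  have hlt : ∀ a b, a < b → z a < z b := fun a b hab => by
    have := hp a b hab
    simp only [hz]
    omega
  have h01 := hlt 0 1 (by decide)
  have h12 := hlt 1 2 (by decide)
  have h23 := hlt 2 3 (by decide)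
  have h34 := hlt 3 4 (by decide)
  have h45 := hlt 4 5 (by decide)
  have h50 : z 5 < z 0 + n := by
    have := steps_lt p (v 5)
    simp only [hz]
    omega
  rcases hf with rfl | rfl
  · obtain ⟨a, ha⟩ := IsLift.exists_edge (n := n) h01 (by linarith)
    obtain ⟨b, hb⟩ := IsLift.exists_edge (n := n) h23 (by linarith)
    obtain ⟨c, hc⟩ := IsLift.exists_edge (n := n) h45 (by linarith)
    refine ⟨a, b, c, ⟨_, _, _, _, ha, hb, h12, by linarith⟩,
      ⟨_, _, _, _, ha, hc, by linarith, by linarith⟩, ⟨_, _, _, _, hb, hc, h34, by linarith⟩, ?_⟩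
    simp only [hv, ha.X_eq, hb.X_eq, hc.X_eq]
  · obtain ⟨a, ha⟩ := IsLift.exists_edge (n := n) (show z 0 < z 5 by linarith) (by linarith)
    obtain ⟨b, hb⟩ := IsLift.exists_edge (n := n) (show z 1 < z 4 by linarith) (by linarith)
    obtain ⟨c, hc⟩ := IsLift.exists_edge (n := n) h23 (by linarith)
    refine ⟨a, b, c, ha.adj_of_nested hb h01 h45, ha.adj_of_nested hc (by linarith) (by linarith),
      hb.adj_of_nested hc h12 h34, ?_⟩
    simp only [hv, ha.X_eq, hb.X_eq, hc.X_eq]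

lemma mul_mem_oddCycleMonomials {V K : Type*} [Field K] {G : SimpleGraph V} {a b c : V}
    (hab : G.Adj a b) (hac : G.Adj a c) (hbc : G.Adj b c) :
    (X a * X b * X c : MvPolynomial V K) ∈ oddCycleMonomials K G := by
  classical
  set e : ℕ → V := fun t => ![a, b, c] (Fin.ofNat 3 t) with he
  have hper : Function.Periodic e 3 := fun t => by
    simp only [he]
    congr 1
    ext
    simp
  have hadj : ∀ i j : Fin 3, i ≠ j → G.Adj (![a, b, c] i) (![a, b, c] j) := by
    intro i j hij
    fin_cases i <;> fin_cases j <;> simp_all [SimpleGraph.adj_comm]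
  have hadj' : ∀ t d, 1 ≤ d → d < 3 → G.Adj (e t) (e (t + d)) := by
    intro t d h1 h2
    refine hadj _ _ fun h => ?_
    have := congrArg Fin.val h
    simp only [Fin.ofNat] at this
    omega
  refine ⟨{a, b, c}, 3, e, ⟨⟨fun t => hadj' t 1 le_rfl (by norm_num), hper⟩, ⟨1, rfl⟩, le_rfl,
    fun t d h1 h2 => (hadj' t d h1 h2).ne, fun t d h1 h2 => by omega⟩, ?_, ?_⟩
  · ext v
    simp only [Finset.coe_insert, Finset.coe_singleton, Set.mem_insert_iff, Set.mem_singleton_iff,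
      Set.mem_range]
    constructor
    · rintro (rfl | rfl | rfl)
      exacts [⟨0, rfl⟩, ⟨1, rfl⟩, ⟨2, rfl⟩]
    · rintro ⟨t, rfl⟩
      simp only [he]
      generalize Fin.ofNat 3 t = i
      fin_cases i <;> simp
  · rw [Finset.prod_insert (by simp [hab.ne, hac.ne]), Finset.prod_insert (by simp [hbc.ne]),
      Finset.prod_singleton, mul_assoc]

end Triangles

/-! ### From induced odd cycles of length at least five to admissible sequences -/

section LongCycles

variable {n : ℕ} [NeZero n] {N : ℕ} {e : ℕ → Edge n}

/-- Lifts of the edges of a closed walk, each one lying in the gap after the preceding one. -/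
structure IsLiftedWalk (e : ℕ → Edge n) (α β : ℕ → ℤ) : Prop where
  isLift : ∀ t, IsLift (e t) (α t) (β t)
  lt : ∀ t, β t < α (t + 1)
  lt_add : ∀ t, β (t + 1) < α t + n

/-- The next edge could only fail to lie in the gap by lying on the other side of `e (t + 1)`. Then
`e (t + 1)` would separate it from `e t`, giving a chord of the cycle. -/
lemma IsInducedOddCycle.exists_isLiftedWalk (he : IsInducedOddCycle (disjointnessGraph n) N e)
    (hN : 5 ≤ N) {a b a' b' : ℤ} (h0 : IsLift (e 0) a b) (h1 : IsLift (e 1) a' b')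
    (h01 : b < a') (h10 : b' < a + n) :
    ∃ α β : ℕ → ℤ, IsLiftedWalk e α β ∧ α 0 = a ∧ β 0 = b ∧ α 1 = a' ∧ β 1 = b' := by
  let P : ℕ → (ℤ × ℤ) × (ℤ × ℤ) → Prop := fun t r =>
    IsLift (e t) r.1.1 r.1.2 ∧ IsLift (e (t + 1)) r.2.1 r.2.2 ∧ r.1.2 < r.2.1 ∧ r.2.2 < r.1.1 + n
  have hstep : ∀ t r, P t r → ∃ s, P (t + 1) (r.2, s) := by
    rintro t ⟨⟨a, b⟩, a', b'⟩ ⟨hab, hab', h1, h2⟩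
    obtain ⟨c, d, hcd, ⟨h3, h4⟩ | ⟨h3, h4⟩⟩ := hab'.cases_of_adj (he.adj (t + 1))
    · exact ⟨(c, d), hab', hcd, h3, h4⟩
    · refine absurd ⟨a, b, c, d, hab, hcd, ?_, ?_⟩ (he.not_adj t 2 le_rfl (by omega))
      · exact h1.trans h3
      · exact h4.trans h2
  choose! next hnext using hstep
  let F : ∀ t, {r // P t r} := fun t => Nat.rec ⟨((a, b), (a', b')), h0, h1, h01, h10⟩
    (fun t r => ⟨(r.1.2, next t r.1), hnext t r.1 r.2⟩) t
  have hF : ∀ t, (F (t + 1)).1.1 = (F t).1.2 := fun t => rfl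
  refine ⟨fun t => (F t).1.1.1, fun t => (F t).1.1.2, ⟨fun t => (F t).2.1, fun t => ?_,
    fun t => ?_⟩, rfl, rfl, rfl, rfl⟩
  · simp only [hF]
    exact (F t).2.2.2.1
  · simp only [hF]
    exact (F t).2.2.2.2

/-- After one period the lift of `e 0` could land in the other orbit of lifts, but then `e 1` would
lie on both sides of `e 0`. Later lifts are determined by their gaps. -/
lemma IsLiftedWalk.exists_winding {α β : ℕ → ℤ} (h : IsLiftedWalk e α β)
    (he : Function.Periodic e N) :
    ∃ w : ℤ, ∀ t, α (t + N) = α t + w * n ∧ β (t + N) = β t + w * n := by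
  have h0 := h.isLift 0
  have hN := h.isLift (0 + N)
  rw [he 0] at hN
  have hN1 := h.isLift (0 + N + 1)
  rw [show 0 + N + 1 = (0 + 1) + N by ring, he (0 + 1), show (0 + 1) + N = 0 + N + 1 by ring] at hN1
  have a0 := h.lt 0
  have b0 := h.lt_add 0
  have aN := h.lt (0 + N)
  have bN := h.lt_add (0 + N)
  have c1 := (h.isLift 1).lt
  have c2 := hN1.lt
  obtain ⟨w, ⟨hα, hβ⟩ | ⟨hα, hβ⟩⟩ := h0.cases hN
  · refine ⟨w, fun t => ?_⟩
    induction t with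
    | zero => exact ⟨hα, hβ⟩
    | succ t ih =>
      have h1 := h.isLift (t + 1)
      have h2 := (h.isLift (t + 1 + N)).add_mul (-w)
      rw [he (t + 1)] at h2
      have h3 := h.lt t
      have h4 := h.lt_add t
      have h5 := h.lt (t + N)
      have h6 := h.lt_add (t + N)
      have h7 := (h.isLift t).lt
      rw [show t + N + 1 = t + 1 + N by ring] at h5 h6
      obtain ⟨h8, h9⟩ := h1.eq_of_window (x := β t) h2 h3 (by linarith) (by linarith) (by linarith)
      constructor <;> linarith
  · exfalso
    obtain ⟨r, ⟨h1, h2⟩ | ⟨h1, h2⟩⟩ := (h.isLift 1).cases hN1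
    · have := eq_zero_of_mul_lt (n := n) (q := r - w) (by linarith [sub_mul r w (n : ℤ)])
        (by linarith [sub_mul r w (n : ℤ)])
      obtain rfl : r = w := by omega
      linarith
    · have := eq_zero_of_mul_lt (n := n) (q := r - w) (by linarith [sub_mul r w (n : ℤ)])
        (by linarith [sub_mul r w (n : ℤ)])
      obtain rfl : r = w := by omega
      linarith

/-- The edge `e (t + 2)` does not lie before the edge `e t`, seen from `e (t + 1)`. -/
def Forward (n : ℕ) (α β : ℕ → ℤ) (t : ℕ) : Prop := α t + n ≤ α (t + 2) ∧ β t + n ≤ β (t + 2)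

/-- Both `e t`, shifted by `n`, and `e (t + 2)` lie in the gap after `e (t + 1)`. They are not
disjoint, hence not strictly nested, hence ordered. -/
lemma IsLiftedWalk.forward_or {α β : ℕ → ℤ} (h : IsLiftedWalk e α β)
    (he : IsInducedOddCycle (disjointnessGraph n) N e) (hN : 5 ≤ N) (t : ℕ) :
    Forward n α β t ∨ (α (t + 2) ≤ α t + n ∧ β (t + 2) ≤ β t + n) := by
  have hn := he.not_adj t 2 le_rfl (by omega)
  have h0 := (h.isLift t).add_mul 1
  rw [one_mul] at h0
  have h2 := h.isLift (t + 2)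
  rcases lt_trichotomy (α t + n) (α (t + 2)) with h3 | h3 | h3
  · refine Or.inl ⟨h3.le, not_lt.1 fun h4 => hn (h0.adj_of_nested h2 h3 h4)⟩
  · rcases le_total (β t + n) (β (t + 2)) with h4 | h4
    · exact Or.inl ⟨h3.le, h4⟩
    · exact Or.inr ⟨h3.ge, h4⟩
  · exact Or.inr ⟨h3.le, not_lt.1 fun h4 => hn (h2.adj_of_nested h0 h3 h4).symm⟩

/-- If `e (t + 3)` ended earlier, it would fit into the gap after the shifted `e t` and give a
chord; this is where length at least five is needed. The bound also excludes turning back, so the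
direction persists. -/
lemma IsLiftedWalk.forward_succ {α β : ℕ → ℤ} (h : IsLiftedWalk e α β)
    (he : IsInducedOddCycle (disjointnessGraph n) N e) (hN : 5 ≤ N) {t : ℕ}
    (hf : Forward n α β t) : α t + 2 * n ≤ β (t + 3) ∧ Forward n α β (t + 1) := by
  have h1 : α t + 2 * n ≤ β (t + 3) := by
    by_contra hlt
    refine he.not_adj t 3 (by norm_num) (by omega) ?_
    have h0 := (h.isLift t).add_mul 1
    rw [one_mul] at h0
    have := h.lt (t + 2)
    exact ⟨_, _, _, _, h0, h.isLift (t + 3), by linarith [hf.2], by linarith⟩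
  refine ⟨h1, (h.forward_or he hN (t + 1)).resolve_right fun h2 => ?_⟩
  have := h.lt_add t
  have h3 : β (t + 3) ≤ β (t + 1) + n := h2.2
  linarith

lemma IsLiftedWalk.forward {α β : ℕ → ℤ} (h : IsLiftedWalk e α β)
    (he : IsInducedOddCycle (disjointnessGraph n) N e) (hN : 5 ≤ N)
    (hf : Forward n α β 0) (t : ℕ) : Forward n α β t := by
  induction t with
  | zero => exact hf
  | succ t ih => exact (h.forward_succ he hN ih).2

lemma chain_lt {I J : ℕ → ℤ} (h1 : ∀ s, I s ≤ J s) (h2 : ∀ s, J s < I (s + 1)) {a b : ℕ}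
    (hab : a < b) : J a < I b := by
  induction b, hab using Nat.le_induction with
  | base => exact h2 a
  | succ b _ ih => exact ih.trans_le ((h1 b).trans (h2 b).le)

lemma IsInducedOddCycle.modEq {V : Type*} {G : SimpleGraph V} {N : ℕ} {e : ℕ → V}
    (he : IsInducedOddCycle G N e) {a b : ℕ} (h : e a = e b) : a ≡ b [MOD N] := by
  have key : ∀ {a b}, a ≤ b → e a = e b → a ≡ b [MOD N] := by
    intro a b hab h
    obtain ⟨d, rfl⟩ := Nat.exists_eq_add_of_le hab
    by_contra hne
    have hd : d % N ≠ 0 := fun h0 => hne (by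
      have := (show d ≡ 0 [MOD N] from h0).add_left a
      exact this.symm)
    refine he.ne a (d % N) (by omega) (Nat.mod_lt _ (by have := he.three_le; omega)) ?_
    rw [h]
    exact eq_of_modEq_of_periodic he.periodic ((Nat.mod_modEq d N).symm.add_left a)
  rcases le_total a b with hab | hab
  · exact key hab h
  · exact (key hab h.symm).symm

lemma prod_eq_of_range_eq {V M ι : Type*} [CommMonoid M] [Fintype ι] {S : Finset V} {g : ι → V}
    (hinj : Function.Injective g) (hS : (S : Set V) = Set.range g) (F : V → M) :
    ∏ v ∈ S, F v = ∏ i, F (g i) := by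
  classical
  have : S = Finset.univ.image g := by
    ext v
    rw [← Finset.mem_coe, hS]
    simp
  rw [this, Finset.prod_image fun i _ j _ h => hinj h]

/-- The walk winds around the circle as few times as its length allows. -/
lemma IsLiftedWalk.winding_eq {α β : ℕ → ℤ} {k : ℕ} (h : IsLiftedWalk e α β)
    (he : IsInducedOddCycle (disjointnessGraph n) (2 * k + 1) e) {w : ℤ}
    (hw : ∀ t, α (t + (2 * k + 1)) = α t + w * n ∧ β (t + (2 * k + 1)) = β t + w * n)
    (hpos : 0 < 2 * w - (2 * k + 1)) : w = k + 1 := by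
  by_contra hne
  have hwk : (k : ℤ) + 2 ≤ w := by omega
  have hn : (0 : ℤ) < n := by exact_mod_cast Nat.pos_of_neZero n
  -- Shift `e (2 * j)` back by `j` turns and take the first one beginning after the end of `e 0`. If
  -- it ends before `α 0 + n`, it is disjoint from `e 0`. Otherwise the preceding `e (2 * i + 1)` is
  -- nested in a lift of `e 0`. The boundary cases `j = k` and `i = 0`, where adjacency is allowed,
  -- fail by comparing ends.
  have hex : ∃ j : ℕ, β 0 < α (2 * j) - j * n := by
    refine ⟨k, ?_⟩
    have h1 := (hw 0).2
    have h2 := h.lt_add (2 * k)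
    rw [zero_add] at h1
    have h3 : ((k : ℤ) + 2) * n ≤ w * n := mul_le_mul_of_nonneg_right hwk hn.le
    linarith
  classical
  have hj := Nat.find_spec hex
  have hmin : ∀ i, i < Nat.find hex → α (2 * i) - i * n ≤ β 0 := fun i hi =>
    not_lt.1 (Nat.find_min hex hi)
  have hjk : Nat.find hex ≤ k ∧ (Nat.find hex = k → α 0 + n < α (2 * k) - k * n) := by
    have h1 := (hw 0).2
    have h2 := h.lt_add (2 * k)
    rw [zero_add] at h1
    have h3 : ((k : ℤ) + 2) * n ≤ w * n := mul_le_mul_of_nonneg_right hwk hn.le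
    have h4 := (h.isLift 0).lt
    exact ⟨Nat.find_min' hex (by linarith), fun _ => by linarith⟩
  generalize Nat.find hex = j at *
  obtain ⟨hjk, hjk'⟩ := hjk
  obtain ⟨i, rfl⟩ : ∃ i, j = i + 1 := by
    refine Nat.exists_eq_succ_of_ne_zero ?_
    rintro rfl
    have := (h.isLift 0).lt
    simp only [mul_zero, Nat.cast_zero, zero_mul, sub_zero] at hj
    linarith
  have h0 := h.isLift 0
  have hi := hmin i (Nat.lt_succ_self i)
  have hlift := (h.isLift (2 * (i + 1))).add_mul (-((i + 1 : ℕ) : ℤ))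
  rcases lt_or_ge (β (2 * (i + 1)) - ((i + 1 : ℕ) : ℤ) * n) (α 0 + n) with h1 | h1
  · rcases hjk.lt_or_eq with h2 | h2
    · refine he.not_adj 0 (2 * (i + 1)) (by omega) (by omega) ?_
      rw [zero_add]
      exact ⟨_, _, _, _, h0, hlift, by linarith, by linarith⟩
    · have h3 := hjk' h2
      have := hlift.lt
      rw [← h2] at h3
      linarith
  · have h2 := h.lt_add (2 * i)
    have h3 := h.lt_add (2 * i + 1)
    rw [show 2 * i + 1 + 1 = 2 * (i + 1) by ring] at h3
    push_cast at h1 h3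
    rcases Nat.eq_zero_or_pos i with rfl | hi0
    · simp only [mul_zero, Nat.cast_zero, zero_mul, zero_add, sub_zero, one_mul] at *
      have := (h.isLift 1).lt
      linarith
    · refine he.not_adj 0 (2 * i + 1) (by omega) (by omega) ?_
      rw [zero_add]
      have h4 := h0.add_mul 1
      rw [one_mul] at h4
      exact h4.adj_of_nested ((h.isLift (2 * i + 1)).add_mul (-i)) (by linarith) (by linarith)

lemma IsLiftedWalk.exists_admissible {α β : ℕ → ℤ} {k : ℕ} (h : IsLiftedWalk e α β)
    (he : IsInducedOddCycle (disjointnessGraph n) (2 * k + 1) e) (hk : 2 ≤ k)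
    (hf : Forward n α β 0) {S : Finset (Edge n)} (hS : (S : Set (Edge n)) = Set.range e) :
    (∏ v ∈ S, X v : MvPolynomial (Edge n) ℂ) ∈ cycleMonomials n := by
  have hf' := h.forward he (by omega) hf
  obtain ⟨w, hw⟩ := h.exists_winding he.periodic
  set I : ℕ → ℤ := fun s => α (2 * s) - s * n with hI
  -- As `2 * (l + k - 1) + 3 = 2 * l + (2 * k + 1)` and the walk winds `k + 1` times, `J (l + k -
  -- 1)` is the other end of the chord starting at `I l`. The shift by `s + 2` turns makes `I s ≤ J
  -- s` the bound of `forward_succ`.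
  set J : ℕ → ℤ := fun s => β (2 * s + 3) - (s + 2) * n with hJ
  have hIJ : ∀ s, I s ≤ J s := fun s => by
    have := (h.forward_succ he (by omega) (hf' (2 * s))).1
    simp only [hI, hJ]
    linarith
  have hJI : ∀ s, J s < I (s + 1) := fun s => by
    have := h.lt_add (2 * s + 2)
    simp only [hI, hJ]
    rw [show 2 * (s + 1) = 2 * s + 2 by ring]
    push_cast
    linarith
  have hn : (0 : ℤ) < n := by exact_mod_cast Nat.pos_of_neZero n
  have hI2 : ∀ s, I (s + (2 * k + 1)) = I s + (2 * w - (2 * k + 1)) * n := fun s => by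
    have h1 := (hw (2 * s + (2 * k + 1))).1
    have h2 := (hw (2 * s)).1
    simp only [hI]
    rw [show 2 * (s + (2 * k + 1)) = 2 * s + (2 * k + 1) + (2 * k + 1) by ring, h1, h2]
    push_cast
    ring
  have hw1 : w = k + 1 := by
    refine h.winding_eq he hw ?_
    have h1 := (hIJ 0).trans_lt (chain_lt hIJ hJI (show 0 < 0 + (2 * k + 1) by omega))
    rw [hI2] at h1
    by_contra hneg
    have := mul_nonneg (show 0 ≤ -(2 * w - (2 * (k : ℤ) + 1)) by omega) hn.le
    linarith
  subst hw1
  have hI3 : ∀ s, I (s + (2 * k + 1)) = I s + n := fun s => by rw [hI2]; ring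
  have hJper : Function.Periodic (fun s => vertex n (J s)) (2 * k + 1) := fun s => by
    have h1 := (hw (2 * s + 3 + (2 * k + 1))).2
    have h2 := (hw (2 * s + 3)).2
    have h3 : J (s + (2 * k + 1)) = J s + 1 * n := by
      simp only [hJ]
      rw [show 2 * (s + (2 * k + 1)) + 3 = 2 * s + 3 + (2 * k + 1) + (2 * k + 1) by ring, h1, h2]
      push_cast
      ring
    simp only [h3, vertex_add_mul]
  refine ⟨k, hk, fun l => vertex n (I l), fun l => vertex n (J l), ⟨vertex n (I 0), ?_, ?_⟩, ?_⟩
  · have hIle : ∀ a : Fin (2 * k + 1), I 0 ≤ I a := fun a => by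
      rcases Nat.eq_zero_or_pos a.val with h0 | h0
      · rw [h0]
      · exact (hIJ 0).trans (chain_lt hIJ hJI h0).le
    intro a
    have h1 := hIle a
    have h2 := hIJ a
    have h3 := chain_lt hIJ hJI (show a.val < 0 + (2 * k + 1) by omega)
    rw [hI3] at h3
    have h4 := coe_steps_vertex_of_le h1 (by linarith)
    have h5 := coe_steps_vertex_of_le (h1.trans h2) h3
    simp only
    omega
  · intro a b hab
    have h0 : I 0 ≤ J a := by
      rcases Nat.eq_zero_or_pos a.val with h0 | h0
      · rw [h0]; exact hIJ 0
      · exact (hIJ 0).trans ((chain_lt hIJ hJI h0).le.trans (hIJ a))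
    have h1 := chain_lt hIJ hJI (show a.val < b.val from hab)
    have h3 := (hIJ b).trans_lt (chain_lt hIJ hJI (show b.val < 0 + (2 * k + 1) by omega))
    rw [hI3] at h3
    have h4 := coe_steps_vertex_of_le (h0.trans h1.le) h3
    have h5 := coe_steps_vertex_of_le h0 (h1.trans h3)
    simp only
    omega
  · have hinj : Function.Injective fun l : Fin (2 * k + 1) => e (2 * l) := by
      intro a b hab
      have h1 := he.modEq hab
      have hcop : Nat.gcd (2 * k + 1) 2 = 1 := by
        rw [Nat.gcd_comm]
        simp
      have h2 := Nat.ModEq.cancel_left_of_coprime hcop h1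
      exact Fin.ext (h2.eq_of_lt_of_lt a.isLt b.isLt)
    have hrange : (S : Set (Edge n)) = Set.range fun l : Fin (2 * k + 1) => e (2 * l) := by
      rw [hS]
      apply Set.Subset.antisymm
      · rintro _ ⟨s, rfl⟩
        -- `k + 1` is the inverse of `2` modulo `2 * k + 1`.
        refine ⟨⟨(k + 1) * s % (2 * k + 1), Nat.mod_lt _ (by omega)⟩, ?_⟩
        refine eq_of_modEq_of_periodic he.periodic ?_
        refine ((Nat.mod_modEq _ _).mul_left 2).trans ?_
        rw [show 2 * ((k + 1) * s) = s + (2 * k + 1) * s by ring]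
        simp [Nat.ModEq]
      · rintro _ ⟨l, rfl⟩
        exact ⟨_, rfl⟩
    rw [prod_eq_of_range_eq hinj hrange, cycleMonomial]
    refine Finset.prod_congr rfl fun l _ => ?_
    have hlift := (h.isLift (2 * l)).add_mul (-(l.val : ℤ))
    have h1 : vertex n (J (Fin.ofNat (2 * k + 1) (l.val + k - 1)).val) =
        vertex n (β (2 * l) + -(l.val : ℤ) * n) := by
      refine (hJper.map_mod_nat (l.val + k - 1)).trans ?_
      simp only [hJ]
      obtain ⟨m, rfl⟩ : ∃ m, k = m + 1 := ⟨k - 1, by omega⟩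
      rw [show l.val + (m + 1) - 1 = l.val + m by omega,
        show 2 * (l.val + m) + 3 = 2 * l.val + (2 * (m + 1) + 1) by ring, (hw _).2]
      congr 1
      push_cast
      ring
    rw [h1, hlift.X_eq]
    congr 2
    simp only [hI]
    ring

/-- Running through an induced odd cycle backwards, starting from its vertex with index `2`. -/
lemma IsInducedOddCycle.reverse {V : Type*} {G : SimpleGraph V} {N : ℕ} {e : ℕ → V}
    (he : IsInducedOddCycle G N e) :
    IsInducedOddCycle G N (fun t => e (2 + (N - 1) * t)) ∧
      Set.range (fun t => e (2 + (N - 1) * t)) = Set.range e := by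
  have h3 := he.three_le
  have hodd := he.odd
  obtain ⟨m, rfl⟩ : ∃ m, N = m + 1 := ⟨N - 1, by omega⟩
  simp only [Nat.add_sub_cancel]
  have hper : ∀ t, e (t + (m + 1)) = e t := he.periodic
  -- With `N = m + 1`, the index `2 + m * t` is `2 - t` modulo `N`.
  have hback : ∀ t d, 1 ≤ d → d < m + 1 →
      e (2 + m * (t + d)) = e (2 + m * t + (m + 1 - d)) := by
    intro t d h1 h2
    obtain ⟨c, rfl⟩ : ∃ c, d = c + 1 := ⟨d - 1, by omega⟩
    refine eq_of_modEq_of_periodic he.periodic ?_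
    obtain ⟨r, rfl⟩ : ∃ r, m = c + 1 + r := ⟨m - (c + 1), by omega⟩
    rw [show c + 1 + r + 1 - (c + 1) = r + 1 by omega,
      show 2 + (c + 1 + r) * (t + (c + 1)) =
        2 + (c + 1 + r) * t + (r + 1) + (c + 1 + r + 1) * c by ring]
    simp [Nat.ModEq]
  refine ⟨⟨⟨fun t => ?_, fun t => ?_⟩, hodd, h3, fun t d h1 h2 => ?_, fun t d h1 h2 => ?_⟩, ?_⟩
  · have := he.adj (2 + m * (t + 1))
    rw [show 2 + m * (t + 1) + 1 = 2 + m * t + (m + 1) by ring, hper] at this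
    exact this.symm
  · refine eq_of_modEq_of_periodic he.periodic ?_
    rw [show 2 + m * (t + (m + 1)) = 2 + m * t + (m + 1) * m by ring]
    simp [Nat.ModEq]
  · simp only [hback t d h1 h2]
    exact he.ne _ _ (by omega) (by omega)
  · simp only [hback t d (by omega) (by omega)]
    exact he.not_adj _ _ (by omega) (by omega)
  · apply Set.Subset.antisymm
    · rintro _ ⟨t, rfl⟩
      exact ⟨_, rfl⟩
    · rintro _ ⟨s, rfl⟩
      refine ⟨2 + m * s, ?_⟩
      refine eq_of_modEq_of_periodic he.periodic ?_
      obtain ⟨c, rfl⟩ : ∃ c, m = c + 1 := ⟨m - 1, by omega⟩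
      rw [show 2 + (c + 1) * (2 + (c + 1) * s) = s + (c + 1 + 1) * (2 + c * s) by ring]
      simp [Nat.ModEq]

lemma prod_mem_of_isInducedOddCycle {S : Finset (Edge n)}
    (he : IsInducedOddCycle (disjointnessGraph n) N e)
    (hS : (S : Set (Edge n)) = Set.range e) :
    (∏ v ∈ S, X v : MvPolynomial (Edge n) ℂ) ∈ tripleMonomials n ∪ cycleMonomials n := by
  obtain ⟨k, rfl⟩ := he.odd
  have h3 := he.three_le
  rcases Nat.lt_or_ge k 2 with hk | hk
  · obtain rfl : k = 1 := by omega
    left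
    have hinj : Function.Injective fun l : Fin 3 => e l := by
      intro a b hab
      exact Fin.ext ((he.modEq hab).eq_of_lt_of_lt a.isLt b.isLt)
    have hrange : (S : Set (Edge n)) = Set.range fun l : Fin 3 => e l := by
      rw [hS]
      apply Set.Subset.antisymm
      · rintro _ ⟨s, rfl⟩
        exact ⟨⟨s % 3, Nat.mod_lt _ (by omega)⟩, he.periodic.map_mod_nat s⟩
      · rintro _ ⟨l, rfl⟩
        exact ⟨_, rfl⟩
    rw [prod_eq_of_range_eq hinj hrange, Fin.prod_univ_three]
    have h2 := he.adj 2
    have h30 : e (2 + 1) = e 0 := he.periodic 0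
    rw [h30] at h2
    exact mul_mem_tripleMonomials (he.adj 0) h2.symm (he.adj 1)
  · right
    obtain ⟨a, b, a', b', h0, h1, h01, h10⟩ := he.adj 0
    obtain ⟨α, β, h, rfl, rfl, rfl, rfl⟩ := he.exists_isLiftedWalk (by omega) h0 h1 h01 h10
    rcases h.forward_or he (by omega) 0 with hf | ⟨hα, hβ⟩
    · exact h.exists_admissible he hk hf hS
    -- A walk going backward goes forward when reversed: from `e 2`, the lifts of `e 1` and `e 0`
    -- are shifted by `n` and `2 * n`.
    · obtain ⟨he', hrange⟩ := he.reverse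
      have hper : ∀ t, e (t + (2 * k + 1)) = e t := he.periodic
      have e0 : e (2 + (2 * k + 1 - 1) * 0) = e 2 := rfl
      have e1 : e (2 + (2 * k + 1 - 1) * 1) = e 1 := by
        rw [← hper 1]; congr 1; omega
      have e2 : e (2 + (2 * k + 1 - 1) * 2) = e 0 := by
        rw [← hper 0, ← hper (0 + _)]; congr 1; omega
      have l1 := (h.isLift 1).add_mul 1
      rw [one_mul] at l1
      obtain ⟨α', β', h', hα0, hβ0, hα1, hβ1⟩ := he'.exists_isLiftedWalk (by omega)
        (a := α 2) (b := β 2) (by simpa only [e0] using h.isLift 2)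
        (a' := α 1 + n) (b' := β 1 + n) (by simpa only [e1] using l1) (h.lt_add 1)
        (by linarith [h.lt 1])
      refine h'.exists_admissible he' hk ?_ (hS.trans hrange.symm)
      have l2 := h'.isLift 2
      simp only [e2] at l2
      have c1 := h'.lt 1
      have c2 := h'.lt_add 1
      have c3 := h.lt 0
      have c4 := h.lt_add 0
      have c5 := (h.isLift 1).lt
      have c6 := (h.isLift 0).lt
      simp only [zero_add, one_add_one_eq_two] at c1 c2 c3 c4 hα hβ
      rw [hβ1] at c1
      rw [hα1] at c2
      obtain ⟨h3, h4⟩ := ((h.isLift 0).add_mul 2).eq_of_window (x := β 1 + n) l2 (by linarith)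
        (by linarith) (by linarith) (by linarith)
      refine ⟨?_, ?_⟩
      · simp only [zero_add]
        rw [hα0, h3]
        linarith
      · simp only [zero_add]
        rw [hβ0, h4]
        linarith

end LongCycles

/-! ### From admissible sequences to induced odd cycles -/

section Admissible

lemma Admissible.injective {n m : ℕ} {i j : Fin m → Fin n} (h : Admissible i j) :
    Function.Injective i := by
  obtain ⟨p, h1, h2⟩ := h
  have key : ∀ a b, a < b → i a ≠ i b := by
    intro a b hab heq
    have h3 := h1 a
    have h4 := h2 a b hab
    rw [heq] at h3
    omega
  intro a b hab
  by_contra hne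
  rcases lt_or_gt_of_ne hne with h | h
  · exact key a b h hab
  · exact key b a h hab.symm

variable {n : ℕ} [NeZero n]

/-- The cyclic sequence of edges `E`, with the adjacencies `l ~ l ± k` modulo `2 k + 1`, is an
induced odd cycle when read in steps of `k`. -/
lemma isInducedOddCycle_of_circulant {V : Type*} {G : SimpleGraph V} {k : ℕ} (hk : 2 ≤ k)
    {E : ℕ → V} (hper : Function.Periodic E (2 * k + 1)) (hadj : ∀ l, G.Adj (E l) (E (l + k)))
    (hne : ∀ l d, 1 ≤ d → d < k → E l ≠ E (l + d))
    (hnadj : ∀ l d, 1 ≤ d → d < k → ¬ G.Adj (E l) (E (l + d))) :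
    IsInducedOddCycle G (2 * k + 1) (fun t => E (t * k)) ∧
      Set.range (fun t => E (t * k)) = Set.range E ∧
      Function.Injective fun l : Fin (2 * k + 1) => E l := by
  have hper' : ∀ l, E (l + (2 * k + 1)) = E l := hper
  have hne' : ∀ l d, 1 ≤ d → d < 2 * k + 1 → E l ≠ E (l + d) := by
    intro l d h1 h2
    rcases Nat.lt_or_ge d k with h | h
    · exact hne l d h1 h
    · rcases h.eq_or_lt with rfl | h
      · exact (hadj l).ne
      · rcases Nat.lt_or_ge d (k + 2) with h' | h'
        · obtain rfl : d = k + 1 := by omega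
          have := (hadj (l + (k + 1))).ne
          rw [show l + (k + 1) + k = l + (2 * k + 1) by ring, hper'] at this
          exact this.symm
        · have := hne (l + d) (2 * k + 1 - d) (by omega) (by omega)
          rw [show l + d + (2 * k + 1 - d) = l + (2 * k + 1) by omega, hper'] at this
          exact this.symm
  have hnadj' : ∀ l d, k + 2 ≤ d → d < 2 * k + 1 → ¬ G.Adj (E l) (E (l + d)) := by
    intro l d h1 h2 h
    refine hnadj (l + d) (2 * k + 1 - d) (by omega) (by omega) ?_
    rw [show l + d + (2 * k + 1 - d) = l + (2 * k + 1) by omega, hper']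
    exact h.symm
  -- Since `2 * k` is `-1` modulo `2 * k + 1`, taking `2 * q` steps of size `k` moves by `-q`, and
  -- `2 * q + 1` steps move by `k - q`.
  have heven : ∀ t q, 1 ≤ q → q ≤ k → E ((t + 2 * q) * k) = E (t * k + (2 * k + 1 - q)) := by
    intro t q h1 h2
    obtain ⟨c, rfl⟩ : ∃ c, q = c + 1 := ⟨q - 1, by omega⟩
    obtain ⟨r, rfl⟩ : ∃ r, k = c + 1 + r := ⟨k - (c + 1), by omega⟩
    refine eq_of_modEq_of_periodic hper ?_
    rw [show 2 * (c + 1 + r) + 1 - (c + 1) = c + 2 + 2 * r by omega,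
      show (t + 2 * (c + 1)) * (c + 1 + r) =
        t * (c + 1 + r) + (c + 2 + 2 * r) + (2 * (c + 1 + r) + 1) * c by ring]
    simp [Nat.ModEq]
  have hodd : ∀ t q, q < k → E ((t + (2 * q + 1)) * k) = E (t * k + (k - q)) := by
    intro t q h2
    obtain ⟨r, rfl⟩ : ∃ r, k = q + r := ⟨k - q, by omega⟩
    refine eq_of_modEq_of_periodic hper ?_
    rw [show q + r - q = r by omega,
      show (t + (2 * q + 1)) * (q + r) = t * (q + r) + r + (2 * (q + r) + 1) * q by ring]
    simp [Nat.ModEq]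
  refine ⟨⟨⟨fun t => ?_, fun t => ?_⟩, ⟨k, rfl⟩, by omega, fun t d h1 h2 => ?_,
    fun t d h1 h2 => ?_⟩, ?_, ?_⟩
  · have := hadj (t * k)
    rwa [show t * k + k = (t + 1) * k by ring] at this
  · refine eq_of_modEq_of_periodic hper ?_
    rw [show (t + (2 * k + 1)) * k = t * k + (2 * k + 1) * k by ring]
    simp [Nat.ModEq]
  · obtain ⟨q, hq | hq⟩ := Nat.even_or_odd' d
    · subst hq
      simp only [heven t q (by omega) (by omega)]
      exact hne' _ _ (by omega) (by omega)
    · subst hq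
      simp only [hodd t q (by omega)]
      exact hne' _ _ (by omega) (by omega)
  · obtain ⟨q, hq | hq⟩ := Nat.even_or_odd' d
    · subst hq
      simp only [heven t q (by omega) (by omega)]
      exact hnadj' _ _ (by omega) (by omega)
    · subst hq
      simp only [hodd t q (by omega)]
      exact hnadj _ _ (by omega) (by omega)
  · apply Set.Subset.antisymm
    · rintro _ ⟨t, rfl⟩
      exact ⟨_, rfl⟩
    · rintro _ ⟨l, rfl⟩
      -- `2 * k - 1` is `-2` modulo `2 * k + 1`, the inverse of `k`.
      refine ⟨(2 * k - 1) * l, ?_⟩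
      refine eq_of_modEq_of_periodic hper ?_
      obtain ⟨c, rfl⟩ : ∃ c, k = c + 1 := ⟨k - 1, by omega⟩
      rw [show 2 * (c + 1) - 1 = 2 * c + 1 by omega,
        show (2 * c + 1) * l * (c + 1) = l + (2 * (c + 1) + 1) * (c * l) by ring]
      simp [Nat.ModEq]
  · have key : ∀ a b : Fin (2 * k + 1), a < b → E a ≠ E b := by
      intro a b hab
      have hab' : a.val < b.val := hab
      have := hne' a (b - a) (by omega) (by omega)
      rwa [show a.val + (b.val - a.val) = b by omega] at this
    intro a b hab
    by_contra hne
    rcases lt_or_gt_of_ne hne with h | h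
    · exact key a b h hab
    · exact key b a h hab.symm

/-- The periodic lift of an admissible sequence to the integers. -/
lemma Admissible.exists_chain {N : ℕ} [NeZero N] {i j : Fin N → Fin n} (h : Admissible i j) :
    ∃ I J : ℕ → ℤ, (∀ t, vertex n (I t) = i (Fin.ofNat N t)) ∧
      (∀ t, vertex n (J t) = j (Fin.ofNat N t)) ∧ (∀ t, I t ≤ J t) ∧ (∀ t, J t < I (t + 1)) ∧
      (∀ t, I (t + N) = I t + n) ∧ ∀ t, J (t + N) = J t + n := by
  obtain ⟨p, h1, h2⟩ := h
  have hN : 0 < N := Nat.pos_of_neZero N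
  set I : ℕ → ℤ := fun t => p.val + steps p (i (Fin.ofNat N t)) + (t / N : ℕ) * n with hI
  set J : ℕ → ℤ := fun t => p.val + steps p (j (Fin.ofNat N t)) + (t / N : ℕ) * n with hJ
  have hvI : ∀ t, vertex n (I t) = i (Fin.ofNat N t) := fun t => by
    simp only [hI, vertex_add_mul, vertex_add_steps]
  have hvJ : ∀ t, vertex n (J t) = j (Fin.ofNat N t) := fun t => by
    simp only [hJ, vertex_add_mul, vertex_add_steps]
  have hIJ : ∀ t, I t ≤ J t := fun t => by
    have := h1 (Fin.ofNat N t)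
    simp only [hI, hJ]
    linarith [show (steps p (i (Fin.ofNat N t)) : ℤ) ≤ steps p (j (Fin.ofNat N t)) by
      exact_mod_cast this]
  have hJI : ∀ t, J t < I (t + 1) := fun t => by
    have hlt : t % N < N := Nat.mod_lt _ hN
    have hmod : (t + 1) % N = (t % N + 1) % N := by simp
    have hdm := Nat.div_add_mod t N
    have hdm' := Nat.div_add_mod (t + 1) N
    simp only [hI, hJ]
    rcases Nat.lt_or_ge (t % N + 1) N with h | h
    · rw [Nat.mod_eq_of_lt h] at hmod
      have hdiv : (t + 1) / N = t / N := by
        refine Nat.eq_of_mul_eq_mul_left hN ?_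
        omega
      have := h2 (Fin.ofNat N t) (Fin.ofNat N (t + 1)) (by
        change t % N < (t + 1) % N
        omega)
      rw [hdiv]
      omega
    · have hmod0 : (t + 1) % N = 0 := by
        rw [hmod, show t % N + 1 = N by omega, Nat.mod_self]
      have hdiv : (t + 1) / N = t / N + 1 := by
        refine Nat.eq_of_mul_eq_mul_left hN ?_
        rw [mul_add, mul_one]
        omega
      have := steps_lt p (j (Fin.ofNat N t))
      rw [hdiv]
      push_cast
      linarith [show (0 : ℤ) ≤ steps p (i (Fin.ofNat N (t + 1))) by positivity,
        show (steps p (j (Fin.ofNat N t)) : ℤ) < n by exact_mod_cast this]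
  have hofNat : ∀ t, Fin.ofNat N (t + N) = Fin.ofNat N t := fun t => by
    ext
    simp
  have hI1 : ∀ t, I (t + N) = I t + n := fun t => by
    simp only [hI, hofNat, Nat.add_div_right t hN]
    push_cast
    ring
  have hJ1 : ∀ t, J (t + N) = J t + n := fun t => by
    simp only [hJ, hofNat, Nat.add_div_right t hN]
    push_cast
    ring
  exact ⟨I, J, hvI, hvJ, hIJ, hJI, hI1, hJ1⟩

/-- Chord `l` runs from `I l` to `J (l + k - 1)`. Chord `l + k` begins after that end and finishes
before `I l + n`, whereas the chords `l + d` with `0 < d < k` begin no later than that end and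
finish beyond it, so they meet chord `l`. -/
lemma Admissible.exists_edges {k : ℕ} (hk : 1 < k) {i j : Fin (2 * k + 1) → Fin n}
    (h : Admissible i j) : ∃ E : ℕ → Edge n,
      Function.Periodic E (2 * k + 1) ∧ (∀ l, (disjointnessGraph n).Adj (E l) (E (l + k))) ∧
      (∀ l d, 1 ≤ d → d < k → E l ≠ E (l + d)) ∧
      (∀ l d, 1 ≤ d → d < k → ¬ (disjointnessGraph n).Adj (E l) (E (l + d))) ∧
      cycleMonomial i j = ∏ l : Fin (2 * k + 1), X (E l) := by
  obtain ⟨I, J, hvI, hvJ, hIJ, hJI, hI1, hJ1⟩ := h.exists_chain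
  have hc : ∀ {a b}, a < b → J a < I b := fun hab => chain_lt hIJ hJI hab
  have hIm : ∀ {a b}, a < b → I a < I b := fun hab => (hIJ _).trans_lt (hc hab)
  have hJm : ∀ {a b}, a < b → J a < J b := fun hab => (hc hab).trans_le (hIJ _)
  have hex : ∀ l, ∃ e : Edge n, IsLift e (I l) (J (l + k - 1)) := fun l =>
    IsLift.exists_edge ((hIJ l).trans_lt (hJm (by omega))) (by
      rw [← hI1]
      exact hc (by omega))
  choose E hE using hex
  have hcross : ∀ l d, 1 ≤ d → d < k → J (l + d + k - 1) < I l + n := fun l d _ _ => by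
    rw [← hI1]
    exact hc (by omega)
  refine ⟨E, fun l => ?_, fun l => ?_, fun l d hd hdk => ?_, fun l d hd hdk => ?_, ?_⟩
  · refine (hE (l + (2 * k + 1))).edge_eq ?_
    have := (hE l).add_mul 1
    rwa [one_mul, ← hI1, ← hJ1, show l + k - 1 + (2 * k + 1) = l + (2 * k + 1) + k - 1 by omega] at this
  · refine ⟨_, _, _, _, hE l, hE (l + k), hc (by omega), ?_⟩
    rw [← hI1]
    exact hc (by omega)
  · exact (hE l).ne_of_crossing (hE (l + d)) (hIm (by omega)) (hJm (by omega)) (hcross l d hd hdk)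
  · refine (hE l).not_adj_of_crossing (hE (l + d)) (hIm (by omega)).le ?_ (hJm (by omega)).le
      (hcross l d hd hdk).le
    rcases Nat.lt_or_ge (l + d) (l + k - 1) with h | h
    · exact (hIm h).le.trans (hIJ _)
    · rw [show l + k - 1 = l + d by omega]
      exact hIJ _
  · rw [cycleMonomial]
    refine Finset.prod_congr rfl fun l _ => ?_
    rw [(hE l).X_eq, hvI, hvJ]
    congr 2
    simp

/-- The classification of the induced odd cycles of the disjointness graph. -/
theorem oddCycleMonomials_disjointnessGraph :
    oddCycleMonomials ℂ (disjointnessGraph n) = tripleMonomials n ∪ cycleMonomials n := by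
  classical
  apply Set.Subset.antisymm
  · rintro _ ⟨S, N, e, he, hS, rfl⟩
    exact prod_mem_of_isInducedOddCycle he hS
  · rintro f (hf | ⟨k, hk, i, j, h, rfl⟩)
    · obtain ⟨a, b, c, hab, hac, hbc, rfl⟩ := exists_adj_of_mem_tripleMonomials hf
      exact mul_mem_oddCycleMonomials hab hac hbc
    · obtain ⟨E, hper, hadj, hne, hnadj, heq⟩ := h.exists_edges hk
      obtain ⟨he, hrange, hinj⟩ := isInducedOddCycle_of_circulant hk hper hadj hne hnadj
      have hrange' : Set.range (fun l : Fin (2 * k + 1) => E l) = Set.range E := by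
        apply Set.Subset.antisymm
        · rintro _ ⟨l, rfl⟩
          exact ⟨_, rfl⟩
        · rintro _ ⟨s, rfl⟩
          exact ⟨⟨s % (2 * k + 1), Nat.mod_lt _ (by omega)⟩, hper.map_mod_nat s⟩
      refine ⟨Finset.univ.image fun l : Fin (2 * k + 1) => E l, _, _, he, ?_, ?_⟩
      · rw [hrange, ← hrange']
        simp
      · rw [heq, Finset.prod_image fun a _ b _ h => hinj h]

end Admissible

/-! ### Degrees -/

section Degrees

variable {n : ℕ} [NeZero n]

lemma totalDegree_prod_X {V ι : Type*} (S : Finset ι) (g : ι → V) :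
    (∏ i ∈ S, X (g i) : MvPolynomial V ℂ).totalDegree = S.card := by
  classical
  rw [prod_X_eq_monomial, totalDegree_monomial _ one_ne_zero]
  change Finsupp.degree _ = _
  simp

lemma totalDegree_of_mem_tripleMonomials {f : MvPolynomial (Edge n) ℂ}
    (hf : f ∈ tripleMonomials n) : f.totalDegree = 3 := by
  obtain ⟨a, b, c, -, -, -, rfl⟩ := exists_adj_of_mem_tripleMonomials hf
  have := totalDegree_prod_X (Finset.univ : Finset (Fin 3)) ![a, b, c]
  rwa [Fin.prod_univ_three] at this

lemma totalDegree_cycleMonomial {k : ℕ} (hk : 1 < k) {i j : Fin (2 * k + 1) → Fin n}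
    (h : Admissible i j) : (cycleMonomial i j).totalDegree = 2 * k + 1 := by
  obtain ⟨E, -, -, -, -, heq⟩ := h.exists_edges hk
  rw [heq, totalDegree_prod_X]
  simp

lemma steps_zero_left (v : Fin n) : steps 0 v = v.val := by simp [steps]

/-- The `i_l` are distinct vertices, which bounds the degree by `n`; an odd degree `d ≥ 5` is
attained by taking `i = j` to be the first `d` vertices. -/
lemma totalDegree_image (hn : 6 ≤ n) :
    totalDegree '' (tripleMonomials n ∪ cycleMonomials n) = {d : ℕ | Odd d ∧ 3 ≤ d ∧ d ≤ n} := by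
  apply Set.Subset.antisymm
  · rintro _ ⟨f, hf | ⟨k, hk, i, j, h, rfl⟩, rfl⟩
    · rw [totalDegree_of_mem_tripleMonomials hf]
      exact ⟨⟨1, rfl⟩, le_rfl, by omega⟩
    · rw [totalDegree_cycleMonomial hk h]
      have := Fintype.card_le_of_injective i h.injective
      simp only [Fintype.card_fin] at this
      exact ⟨⟨k, rfl⟩, by omega, this⟩
  · rintro d ⟨⟨k, rfl⟩, h3, hd⟩
    rcases Nat.lt_or_ge 1 k with hk | hk
    · have h : Admissible (Fin.castLE hd) (Fin.castLE hd) := by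
        refine ⟨0, fun a => le_rfl, fun a b hab => ?_⟩
        rw [steps_zero_left, steps_zero_left]
        exact hab
      exact ⟨_, Or.inr ⟨k, hk, _, _, h, rfl⟩, totalDegree_cycleMonomial hk h⟩
    · obtain rfl : k = 1 := by omega
      have h : (x (Fin.castLE hn 0) (Fin.castLE hn 1) * x (Fin.castLE hn 2) (Fin.castLE hn 3) *
          x (Fin.castLE hn 4) (Fin.castLE hn 5) : MvPolynomial (Edge n) ℂ) ∈
          tripleMonomials n := by
        refine ⟨Fin.castLE hn, ⟨0, fun a b hab => ?_⟩, Or.inl rfl⟩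
        rw [steps_zero_left, steps_zero_left]
        exact hab
      exact ⟨_, Or.inl h, totalDegree_of_mem_tripleMonomials h⟩

end Degrees

/-! ### The pentagon -/

section Pentagon

lemma x_comm {n : ℕ} (i j : Fin n) : x i j = x j i := by
  unfold x
  by_cases h : i = j
  · subst h; rfl
  · rw [dif_neg h, dif_neg (Ne.symm h)]
    congr 1
    exact Subtype.ext Sym2.eq_swap

lemma tripleMonomials_five : tripleMonomials 5 = ∅ := by
  rw [Set.eq_empty_iff_forall_notMem]
  rintro f ⟨v, ⟨p, hp⟩, -⟩
  have hinj : Function.Injective v := by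
    intro a b hab
    by_contra hne
    rcases lt_or_gt_of_ne hne with h | h
    · exact (hp a b h).ne (by rw [hab])
    · exact (hp b a h).ne (by rw [hab])
  have := Fintype.card_le_of_injective v hinj
  simp at this

/-- Five vertices leave room only for `k = 2` with `i = j` a rotation, and every rotation gives the
product of the sides of the pentagon. -/
lemma cycleMonomials_five : cycleMonomials 5 = {x 0 1 * x 1 2 * x 2 3 * x 3 4 * x 0 4} := by
  have key : ∀ p : Fin 5, cycleMonomial (k := 2) (fun a : Fin 5 => p + a) (fun a => p + a) =
      x 0 1 * x 1 2 * x 2 3 * x 3 4 * x 0 4 := by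
    intro p
    have h1 : cycleMonomial (k := 2) (fun a : Fin 5 => p + a) (fun a => p + a) =
        ∏ l : Fin 5, x (p + l) (p + l + 1) := by
      refine Finset.prod_congr rfl fun l _ => ?_
      congr 1
      fin_cases p <;> fin_cases l <;> rfl
    rw [h1]
    refine (Equiv.prod_comp (Equiv.addLeft p) fun l : Fin 5 =>
      (x l (l + 1) : MvPolynomial _ ℂ)).trans ?_
    rw [Fin.prod_univ_five, x_comm 0 4]
    rfl
  apply Set.Subset.antisymm
  · rintro f ⟨k, hk, i, j, h, rfl⟩
    have hle := Fintype.card_le_of_injective i h.injective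
    simp only [Fintype.card_fin] at hle
    obtain rfl : k = 2 := by omega
    obtain ⟨p, hij, hji⟩ := h
    have hval : ∀ a : Fin 5, steps p (i a) = a.val ∧ steps p (j a) = a.val := by
      have h0 := hij 0
      have h1 := hij 1
      have h2 := hij 2
      have h3 := hij 3
      have h4 := hij 4
      have h01 := hji 0 1 (by decide)
      have h12 := hji 1 2 (by decide)
      have h23 := hji 2 3 (by decide)
      have h34 := hji 3 4 (by decide)
      have h5 := steps_lt p (j 4)
      intro a
      fin_cases a <;> simp <;> omega
    have hadd : ∀ v a : Fin 5, steps p v = a.val → v = p + a := by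
      intro v a h
      have : v - p = a := Fin.ext h
      rw [← this, add_sub_cancel]
    have hi : i = fun a => p + a := funext fun a => hadd _ _ (hval a).1
    have hj : j = fun a => p + a := funext fun a => hadd _ _ (hval a).2
    rw [hi, hj]
    exact key p
  · rintro _ rfl
    refine ⟨2, by norm_num, fun a => 0 + a, fun a => 0 + a, ⟨0, fun a => le_rfl, ?_⟩, (key 0).symm⟩
    intro a b hab
    simp only [zero_add, steps_zero_left]
    exact hab

end Pentagon

end Hypersimplex

theorem mainTheorem2 :
    (∀ m : MonomialOrder (Hypersimplex.Edge 5), Hypersimplex.IsCircular m →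
      Hypersimplex.secantIdeal 2 (Hypersimplex.initialIdeal m (Hypersimplex.toricIdeal 5)) =
        Ideal.span {Hypersimplex.x 0 1 * Hypersimplex.x 1 2 * Hypersimplex.x 2 3 *
          Hypersimplex.x 3 4 * Hypersimplex.x 0 4}) ∧
    (∀ n : ℕ, 6 ≤ n → ∀ m : MonomialOrder (Hypersimplex.Edge n), Hypersimplex.IsCircular m →
      Hypersimplex.secantIdeal 2 (Hypersimplex.initialIdeal m (Hypersimplex.toricIdeal n)) =
        Ideal.span (Hypersimplex.tripleMonomials n ∪ Hypersimplex.cycleMonomials n) ∧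
      Hypersimplex.minimalGenerators
          (Hypersimplex.secantIdeal 2
            (Hypersimplex.initialIdeal m (Hypersimplex.toricIdeal n))) =
        Hypersimplex.tripleMonomials n ∪ Hypersimplex.cycleMonomials n ∧
      MvPolynomial.totalDegree ''
          Hypersimplex.minimalGenerators
            (Hypersimplex.secantIdeal 2
              (Hypersimplex.initialIdeal m (Hypersimplex.toricIdeal n))) =
        {d : ℕ | Odd d ∧ 3 ≤ d ∧ d ≤ n}) := by
  refine ⟨fun m hm => ?_, fun n hn m hm => ?_⟩
  · rw [Hypersimplex.initialIdeal_toricIdeal hm, Hypersimplex.secantIdeal_edgeIdeal_eq_span,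
      Hypersimplex.oddCycleMonomials_disjointnessGraph, Hypersimplex.tripleMonomials_five,
      Hypersimplex.cycleMonomials_five, Set.empty_union]
  · have : NeZero n := ⟨by omega⟩
    have hgen : Hypersimplex.minimalGenerators (Hypersimplex.secantIdeal 2
        (Hypersimplex.initialIdeal m (Hypersimplex.toricIdeal n))) =
        Hypersimplex.tripleMonomials n ∪ Hypersimplex.cycleMonomials n := by
      rw [Hypersimplex.initialIdeal_toricIdeal hm,
        Hypersimplex.minimalGenerators_secantIdeal_edgeIdeal,
        Hypersimplex.oddCycleMonomials_disjointnessGraph]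
    refine ⟨?_, hgen, ?_⟩
    · rw [Hypersimplex.initialIdeal_toricIdeal hm, Hypersimplex.secantIdeal_edgeIdeal_eq_span,
        Hypersimplex.oddCycleMonomials_disjointnessGraph]
    · rw [hgen, Hypersimplex.totalDegree_image hn]
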